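/- **Conventions.** A computable structure has as domain a computable subset of $\omega$, and its operations are computable. A set $C\subseteq\omega$ is cohesive if it is infinite and for every c.e. set $W$ either $C\setminus W$ or $C\cap W$ is finite; "for almost every $i$" means for all but finitely many $i\in C$. The cohesive power $\prod_C\mathcal A$ consists of the classes $[\varphi]$ of partial computable functions $\varphi:\omega\to\mathcal A$ defined for almost every $i$, where $\varphi$ and $\psi$ are identified if $\varphi(i)=\psi(i)$ (both defined) for almost every $i$; relations and operations are evaluated at almost every $i$, and $\mathcal A$ embeds into $\prod_C\mathcal A$ by constant functions. Elements of $\prod_C\mathbb N$ outside $\mathbb N$ are called non-standard. A Galois extension $K/F$ is *fully computable* if $K$, $F$ and the embedding $F\to K$ are computable and there are finite Galois subextensions $K_0\subsetneq K_1\subsetneq\cdots$ of $K/F$ with union $K$ such that the fields $K_i$ and the embeddings $F\to K_i$, $K_i\to K$, $K_i\to K_{i+1}$ are uniformly computable, the finite groups $G_i=\mathrm{Gal}(K_i/F)$ are uniformly computable as finite objects (domain, multiplication and number of elements), and the restriction maps $G_m\to G_n$ ($n<m$) and the actions of $G_i$ on $K_i$ are uniformly computable. (Then $K/F$ is infinite.)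 Fix such an extension with its sequence $(K_i)$, and a cohesive set $C$. For $N\in\prod_C\mathbb N$ let $\prod_{C,N}K_i\subseteq\prod_C K$ be the set of classes $[\alpha]$, $\alpha$ partial computable, with $\alpha(i)\in K_{N(i)}$ for almost every $i$. Let $\mathcal T_K$ be the set of finite tuples of elements of $K$, with the extension order, concatenation and arity. $\mathrm{HAut}(\prod_C K/\prod_C F)$ is the group of all bijections $\sigma$ of $\prod_C\mathcal T_K$ that are automorphisms for the extension order and concatenation, preserve the arity (with values in $\prod_C\mathbb N$), satisfy $\sigma(p(\vec a))=p(\sigma(\vec a))$ for all $p\in\prod_C\mathbb Z[x_0,x_1,\dots]$ and $\vec a\in\prod_C\mathcal T_K$ such that the arity of $\vec a$ equals the number of variables of $p$ (pointwise, the least $n$ with $p(i)\in\mathbb Z[x_0,\dots,x_{n-1}]$), and fix every element of $\prod_C\mathcal T_F$. Here elements of $\prod_C K$ are identified with hyper-tuples of arity $1$. For $\sigma\ne\tau$ in this group let $d(\sigma,\tau)=2^{-N}\in\prod_C\mathbb Q$, where $N$ is the least element of $\prod_C\mathbb N$ such that $\sigma$ and $\tau$ differ on $\prod_{C,N}K_i$,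 and let $d(\sigma,\sigma)=0$. Similarly, for $\sigma\neq\tau$ in $\mathrm{Gal}(K/F)$ let $d(\sigma,\tau)=2^{-n}$ with $n\in\mathbb N$ least such that $\sigma$ and $\tau$ differ on $K_n$, and $d(\sigma,\sigma)=0$. Let $\mathrm{INF}$ be the set of the $\sigma\in\mathrm{HAut}(\prod_C K/\prod_C F)$ with infinitesimal hyper-distance from the identity, that is, of the identity and of all $\sigma$ with $d(\mathrm{id},\sigma)=2^{-N}$ for some non-standard $N\in\prod_C\mathbb N$. **Theorem.** Let $K/F$ be a fully computable (infinite) Galois extension and $C$ a cohesive set. The hyper-distance is well defined: for $\sigma\ne\tau$ in $\mathrm{HAut}(\prod_C K/\prod_C F)$ the least $N$ exists. The set $\mathrm{INF}$ is a normal subgroup of $\mathrm{HAut}(\prod_C K/\prod_C F)$, and it consists of exactly the hyper-automorphisms that fix every element of $K$. Restriction to $K$ induces an isomorphism $\Phi$ from $\mathrm{HAut}(\prod_C K/\prod_C F)/\mathrm{INF}$ onto a dense subgroup of $\mathrm{Gal}(K/F)$ (with the Krull topology), and $\Phi$ is isometric: if $\sigma$ and $\tau$ lie in different cosets of $\mathrm{INF}$,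 then $d(\sigma,\tau)=d(\Phi(\sigma\,\mathrm{INF}),\Phi(\tau\,\mathrm{INF}))$, a standard power of $2$ in $\mathbb Q\subseteq\prod_C\mathbb Q$. -/

import Mathlib

open Filter

noncomputable section

universe u v w

/-! ### Cohesive sets and cohesive powers -/

/-- `C` is cohesive: it is infinite, and every c.e. set `W` satisfies `C ⊆* W` or `C ⊆* Wᶜ`. -/
def IsCohesive (C : Set ℕ) : Prop :=
  C.Infinite ∧ ∀ W : ℕ → Prop, REPred W →
    {i | i ∈ C ∧ ¬ W i}.Finite ∨ {i | i ∈ C ∧ W i}.Finite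

/-- "For almost every `i`": `∀ᶠ i in almost C, P i` says `C ⊆* {i | P i}`. -/
def almost (C : Set ℕ) : Filter ℕ := cofinite ⊓ 𝓟 C

theorem eventually_almost_iff {C : Set ℕ} {P : ℕ → Prop} :
    (∀ᶠ i in almost C, P i) ↔ {i | i ∈ C ∧ ¬ P i}.Finite := by
  simp only [almost, Filter.eventually_inf_principal, Filter.eventually_cofinite]
  simp

/-- A naming of the elements of `A` by natural numbers: every element has a name, and a number
names at most one element. A structure whose domain is a subset of `ω` is the case in which every
element has exactly one name, see `Coded`. -/
class Numbered (A : Type u) where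
  /-- `Names n a`: the number `n` names the element `a`. -/
  Names : ℕ → A → Prop
  functional : ∀ {n a b}, Names n a → Names n b → a = b
  total : ∀ a : A, ∃ n, Names n a

/-- An identification of `A` with a subset of `ω`, the range of `code`. -/
class Coded (A : Type u) where
  code : A → ℕ
  code_injective : Function.Injective code


instance (A : Type u) [Coded A] : Numbered A where
  Names n a := Coded.code a = n
  functional h h' := Coded.code_injective (h.trans h'.symm)
  total a := ⟨_, rfl⟩

instance : Numbered ℕ where
  Names n a := a = n
  functional h h' := h.trans h'.symm
  total a := ⟨a, rfl⟩

/-- A rational number is named by (the pair of) its reduced numerator and denominator. -/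
instance : Numbered ℚ where
  Names n q := Nat.pair (Encodable.encode q.num) q.den = n
  functional {n a b} h h' := by
    have := Nat.pair_eq_pair.1 (h.trans h'.symm)
    exact Rat.ext (Encodable.encode_injective this.1) this.2
  total q := ⟨_, rfl⟩

/-- The set of finite tuples of elements of `A`; a tuple is named by the tuple of names of its
entries. -/
instance (A : Type u) [Numbered A] : Numbered (List A) where
  Names n l := ∃ ns : List ℕ, Encodable.encode ns = n ∧ List.Forall₂ Numbered.Names ns l
  functional {n a b} := by
    rintro ⟨ns, h, h₁⟩ ⟨ms, h', h₂⟩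
    obtain rfl := Encodable.encode_injective (h.trans h'.symm)
    clear h h'
    induction h₁ generalizing b with
    | nil => cases h₂; rfl
    | cons hx _ ih =>
      cases h₂ with
      | cons hy ht => rw [Numbered.functional hx hy, ih ht]
  total l := by
    suffices h : ∃ ns : List ℕ, List.Forall₂ Numbered.Names ns l by
      obtain ⟨ns, h⟩ := h
      exact ⟨_, ns, rfl, h⟩
    induction l with
    | nil => exact ⟨[], .nil⟩
    | cons a l ih =>
      obtain ⟨ns, h⟩ := ih
      obtain ⟨n, hn⟩ := Numbered.total a
      exact ⟨n :: ns, .cons hn h⟩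

/-- The polynomial written as the list of terms `c * x₀ ^ e₀ * ⋯ * xₖ ^ eₖ`, one for each member
`(c, [e₀, …, eₖ])` of the list. -/
def polyOfTerms (l : List (ℤ × List ℕ)) : MvPolynomial ℕ ℤ :=
  (l.map fun t => MvPolynomial.C t.1 *
    ∏ j ∈ Finset.range t.2.length, MvPolynomial.X j ^ t.2.getD j 0).sum

theorem exists_polyOfTerms (p : MvPolynomial ℕ ℤ) : ∃ l, polyOfTerms l = p := by
  induction p using MvPolynomial.induction_on' with
  | monomial e c =>
    refine ⟨[(c, (List.range (e.support.sup id + 1)).map e)], ?_⟩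
    simp only [polyOfTerms, List.map_cons, List.map_nil, List.sum_cons, List.sum_nil, add_zero,
      List.length_map, List.length_range]
    rw [MvPolynomial.monomial_eq, Finsupp.prod]
    congr 1
    symm
    rw [Finset.prod_subset (s₂ := Finset.range (e.support.sup id + 1))]
    · refine Finset.prod_congr rfl fun j hj => ?_
      rw [List.getD_eq_getElem _ _ (by simpa using hj)]
      simp
    · intro j hj
      have := Finset.le_sup (f := id) hj
      simp only [id] at this
      exact Finset.mem_range.2 (Nat.lt_succ_of_le this)
    · intro j _ hj
      simp [Finsupp.notMem_support_iff.1 hj]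
  | add p q hp hq =>
    obtain ⟨l, rfl⟩ := hp
    obtain ⟨m, rfl⟩ := hq
    exact ⟨l ++ m, by simp [polyOfTerms]⟩

/-- The canonical presentation of `ℤ[x₀, x₁, …]`: a polynomial is named by any finite list of terms
with that sum. Whether two lists name the same polynomial is decidable, and degrees and
coefficients can be computed from a name. -/
instance : Numbered (MvPolynomial ℕ ℤ) where
  Names n p := ∃ l : List (ℤ × List ℕ), Encodable.encode l = n ∧ polyOfTerms l = p
  functional := by
    rintro n a b ⟨l, h, rfl⟩ ⟨m, h', rfl⟩
    rw [Encodable.encode_injective (h.trans h'.symm)]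
  total p := by
    obtain ⟨l, hl⟩ := exists_polyOfTerms p
    exact ⟨_, l, rfl, hl⟩

/-- The partial function `φ : ω → A` is partial computable: some partial computable function on
numbers has the same domain and computes names of the values of `φ`. -/
def PartialComputable {A : Type u} [Numbered A] (φ : ℕ →. A) : Prop :=
  ∃ ψ : ℕ →. ℕ, Partrec ψ ∧
    ∀ i, ((ψ i).Dom ↔ (φ i).Dom) ∧ ∀ n ∈ ψ i, ∀ a ∈ φ i, Numbered.Names n a

/-- The partial computable functions `φ : ω → A` with `C ⊆* dom φ`. -/
structure CohFun (C : Set ℕ) (A : Type u) [Numbered A] where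
  toFun : ℕ →. A
  computable : PartialComputable toFun
  dom : ∀ᶠ i in almost C, (toFun i).Dom

/-- `φ ≃_C ψ`: for almost every `i`, both `φ i` and `ψ i` are defined, and they are equal. -/
instance CohFun.setoid (C : Set ℕ) (A : Type u) [Numbered A] : Setoid (CohFun C A) where
  r φ ψ := ∀ᶠ i in almost C, ∃ a, a ∈ φ.toFun i ∧ a ∈ ψ.toFun i
  iseqv :=
    { refl := fun φ => φ.dom.mono fun _ h => ⟨_, Part.get_mem h, Part.get_mem h⟩
      symm := fun h => h.mono fun _ ⟨a, h₁, h₂⟩ => ⟨a, h₂, h₁⟩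
      trans := fun h h' => by
        filter_upwards [h, h'] with i ⟨a, h₁, h₂⟩ ⟨b, h₃, h₄⟩
        obtain rfl := Part.mem_unique h₂ h₃
        exact ⟨a, h₁, h₄⟩ }

/-- The (domain of the) cohesive power `∏_C A`. -/
def CohPow (C : Set ℕ) (A : Type u) [Numbered A] : Type u := Quotient (CohFun.setoid C A)

namespace CohPow

variable {C : Set ℕ} {A : Type u} {B : Type v} {D : Type w} [Numbered A] [Numbered B] [Numbered D]

/-- The class `[φ]` of `φ` in the cohesive power. -/
def mk (φ : CohFun C A) : CohPow C A := Quotient.mk _ φ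

theorem mk_eq_mk {φ ψ : CohFun C A} :
    mk φ = mk ψ ↔ ∀ᶠ i in almost C, ∃ a, a ∈ φ.toFun i ∧ a ∈ ψ.toFun i :=
  Quotient.eq (r := CohFun.setoid C A)

/-- The binary relation induced on cohesive powers by the relation `R`:
`[φ]` and `[ψ]` are related if `R (φ i) (ψ i)` for almost every `i`. -/
def Holds₂ (R : A → B → Prop) (x : CohPow C A) (y : CohPow C B) : Prop :=
  ∃ φ ψ, mk φ = x ∧ mk ψ = y ∧
    ∀ᶠ i in almost C, ∃ a ∈ φ.toFun i, ∃ b ∈ ψ.toFun i, R a b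

/-- The ternary relation induced on cohesive powers by the relation `R`. If `R` is the graph of a
(partial) binary operation, this is the graph of the induced operation. -/
def Holds₃ (R : A → B → D → Prop) (x : CohPow C A) (y : CohPow C B) (z : CohPow C D) : Prop :=
  ∃ φ ψ χ, mk φ = x ∧ mk ψ = y ∧ mk χ = z ∧
    ∀ᶠ i in almost C, ∃ a ∈ φ.toFun i, ∃ b ∈ ψ.toFun i, ∃ d ∈ χ.toFun i, R a b d

/-- The induced relation does not depend on the representatives. -/
theorem holds₂_mk {R : A → B → Prop} {φ : CohFun C A} {ψ : CohFun C B} :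
    Holds₂ R (mk φ) (mk ψ) ↔ ∀ᶠ i in almost C, ∃ a ∈ φ.toFun i, ∃ b ∈ ψ.toFun i, R a b := by
  refine ⟨?_, fun h => ⟨φ, ψ, rfl, rfl, h⟩⟩
  rintro ⟨φ', ψ', h₁, h₂, h⟩
  filter_upwards [mk_eq_mk.1 h₁, mk_eq_mk.1 h₂, h] with i ⟨a, ha, ha'⟩ ⟨b, hb, hb'⟩
    ⟨a₁, ha₁, b₁, hb₁, hR⟩
  obtain rfl := Part.mem_unique ha ha₁
  obtain rfl := Part.mem_unique hb hb₁
  exact ⟨a, ha', b, hb', hR⟩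

theorem holds₃_mk {R : A → B → D → Prop} {φ : CohFun C A} {ψ : CohFun C B} {χ : CohFun C D} :
    Holds₃ R (mk φ) (mk ψ) (mk χ) ↔
      ∀ᶠ i in almost C, ∃ a ∈ φ.toFun i, ∃ b ∈ ψ.toFun i, ∃ d ∈ χ.toFun i, R a b d := by
  refine ⟨?_, fun h => ⟨φ, ψ, χ, rfl, rfl, rfl, h⟩⟩
  rintro ⟨φ', ψ', χ', h₁, h₂, h₃, h⟩
  filter_upwards [mk_eq_mk.1 h₁, mk_eq_mk.1 h₂, mk_eq_mk.1 h₃, h] with i ⟨a, ha, ha'⟩ ⟨b, hb, hb'⟩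
    ⟨d, hd, hd'⟩ ⟨a₁, ha₁, b₁, hb₁, d₁, hd₁, hR⟩
  obtain rfl := Part.mem_unique ha ha₁
  obtain rfl := Part.mem_unique hb hb₁
  obtain rfl := Part.mem_unique hd hd₁
  exact ⟨a, ha', b, hb', d, hd', hR⟩

/-- The canonical embedding `A → ∏_C A`. -/
def const (C : Set ℕ) (a : A) : CohPow C A :=
  mk { toFun := fun _ => Part.some a
       computable := by
         obtain ⟨n, hn⟩ := Numbered.total a
         refine ⟨fun _ => Part.some n, (Computable.const n).partrec, fun i => ⟨Iff.rfl, ?_⟩⟩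
         intro m hm b hb
         rw [Part.mem_some_iff.1 hm, Part.mem_some_iff.1 hb]
         exact hn
       dom := Eventually.of_forall fun _ => trivial }

/-- The map `∏_C A → ∏_C B` induced by a computable map `f : A → B`, `[φ] ↦ [f ∘ φ]`. -/
def map (f : A → B)
    (hf : ∃ g : ℕ → ℕ, Computable g ∧ ∀ n a, Numbered.Names n a → Numbered.Names (g n) (f a)) :
    CohPow C A → CohPow C B :=
  Quotient.lift
    (fun φ => mk
      { toFun := fun i => (φ.toFun i).map f
        computable := by
          obtain ⟨g, hg, hgf⟩ := hf
          obtain ⟨ψ, hψ, h⟩ := φ.computable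
          refine ⟨fun i => (ψ i).map g, hψ.map (hg.comp Computable.snd), fun i => ⟨(h i).1, ?_⟩⟩
          intro n hn b hb
          obtain ⟨m, hm, rfl⟩ := (Part.mem_map_iff g).1 hn
          obtain ⟨a, ha, rfl⟩ := (Part.mem_map_iff f).1 hb
          exact hgf _ _ ((h i).2 m hm a ha)
        dom := φ.dom })
    (by
      intro φ ψ h
      refine mk_eq_mk.2 (Eventually.mono h ?_)
      rintro i ⟨a, h₁, h₂⟩
      exact ⟨f a, Part.mem_map f h₁, Part.mem_map f h₂⟩)

/-- The order of `∏_C ℕ`. -/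
instance : LE (CohPow C ℕ) := ⟨Holds₂ (· ≤ ·)⟩

/-- The element `1 / 2 ^ N` of `∏_C ℚ`, for `N` in `∏_C ℕ`. -/
def twoPowNeg (N : CohPow C ℕ) : CohPow C ℚ :=
  map (fun n : ℕ => (1 / 2 ^ n : ℚ))
    ⟨fun n => Nat.pair (Encodable.encode (1 : ℤ)) (2 ^ n), by
      refine Primrec.to_comp (Primrec₂.natPair.comp (Primrec.const _) ?_)
      exact (Primrec.nat_rec₁ 1 (f := fun _ m => 2 * m)
        (Primrec.nat_mul.comp (Primrec.const 2) Primrec.snd)).of_eq fun n => by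
          induction n with
          | zero => rfl
          | succ n ih => simp_all [pow_succ, mul_comm], by
      rintro n m rfl
      have h : (1 / 2 ^ m : ℚ) = ((2 ^ m : ℕ) : ℚ)⁻¹ := by simp
      show Nat.pair _ _ = Nat.pair _ _
      rw [h, Rat.inv_natCast_num_of_pos (by positivity), Rat.inv_natCast_den_of_pos (by positivity)]⟩ N

/-- The non-standard arity of a hyper-tuple. -/
def arity : CohPow C (List A) → CohPow C ℕ :=
  map List.length
    ⟨fun n => ((Encodable.decode n : Option (List ℕ)).getD []).length, by
      exact Computable.list_length.comp
        (Computable.option_getD Computable.decode (Computable.const [])), by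
      rintro n l ⟨ns, rfl, h⟩
      show l.length = _
      simpa using h.length_eq.symm⟩

/-- An element of `∏_C A` as a hyper-tuple of arity `1`. -/
def single : CohPow C A → CohPow C (List A) :=
  map (fun a => [a])
    ⟨fun n => Encodable.encode [n], by
      exact Computable.encode.comp (Computable.list_cons.comp Computable.id (Computable.const [])), by
      intro n a h
      exact ⟨[n], rfl, .cons h .nil⟩⟩

end CohPow

/-! ### Fully computable Galois extensions -/

section Uniform

variable {A : ℕ → Type u} {B : ℕ → Type v} {D : ℕ → Type w}

/-- The maps `f n : A n → B n` are computable uniformly in `n`, with respect to the given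
identifications of `A n` and `B n` with subsets of `ω`. -/
def UniformlyComputableMaps (cA : ∀ n, A n → ℕ) (cB : ∀ n, B n → ℕ) (f : ∀ n, A n → B n) : Prop :=
  ∃ g : ℕ → ℕ → ℕ, Computable₂ g ∧ ∀ n a, g n (cA n a) = cB n (f n a)

/-- The operations `f n : A n × B n → D n` are computable uniformly in `n`. -/
def UniformlyComputableOps (cA : ∀ n, A n → ℕ) (cB : ∀ n, B n → ℕ) (cD : ∀ n, D n → ℕ)
    (f : ∀ n, A n → B n → D n) : Prop :=
  ∃ g : ℕ → ℕ → ℕ → ℕ, Computable (fun t : ℕ × ℕ × ℕ => g t.1 t.2.1 t.2.2) ∧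
    ∀ n a b, g n (cA n a) (cB n b) = cD n (f n a b)

/-- The domains of the `A n`, as subsets of `ω`, are uniformly computable. -/
structure UniformlyComputableDomains (cA : ∀ n, A n → ℕ) : Prop where
  injective : ∀ n, Function.Injective (cA n)
  decidable : ComputablePred fun t : ℕ × ℕ => t.2 ∈ Set.range (cA t.1)

/-- A uniformly computable sequence of fields. -/
structure UniformlyComputableFields [∀ n, Field (A n)] (cA : ∀ n, A n → ℕ) : Prop
    extends UniformlyComputableDomains cA where
  zero : Computable fun n => cA n 0
  one : Computable fun n => cA n 1
  add : UniformlyComputableOps cA cA cA fun _ a b => a + b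
  mul : UniformlyComputableOps cA cA cA fun _ a b => a * b

/-- A uniformly computable sequence of finite groups. Being finite objects, the groups are given
completely: besides the domain and the multiplication, the number of elements is computable. -/
structure UniformlyComputableFiniteGroups [∀ n, Group (A n)] (cA : ∀ n, A n → ℕ) : Prop
    extends UniformlyComputableDomains cA where
  finite : ∀ n, Finite (A n)
  card : Computable fun n => Nat.card (A n)
  one : Computable fun n => cA n 1
  mul : UniformlyComputableOps cA cA cA fun _ a b => a * b

end Uniform

/-- A fully computable (infinite) Galois extension `K/F`, with its exhaustion by finite Galois
subextensions `E 0 ⊊ E 1 ⊊ ⋯`, whose Galois groups are `G n = (E n ≃ₐ[F] E n)`. The fields `E n` and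
the groups `G n` have presentations of their own, `codeE n` and `codeG n`. -/
structure FullyComputableGalois (F : Type u) (K : Type v) [Field F] [Field K] [Algebra F K]
    [Coded F] [Coded K] where
  /-- `(K, F)` is a computable Galois extension. -/
  isGalois : IsGalois F K
  computable_F : UniformlyComputableFields fun _ : ℕ => (Coded.code : F → ℕ)
  computable_K : UniformlyComputableFields fun _ : ℕ => (Coded.code : K → ℕ)
  computable_algebraMap : UniformlyComputableMaps
    (fun _ => (Coded.code : F → ℕ)) (fun _ => (Coded.code : K → ℕ)) (fun _ => algebraMap F K)
  /-- The finite Galois subextensions. -/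
  E : ℕ → IntermediateField F K
  finiteDimensional_E : ∀ n, FiniteDimensional F (E n)
  isGalois_E : ∀ n, IsGalois F (E n)
  E_lt : ∀ n, E n < E (n + 1)
  exists_mem_E : ∀ x : K, ∃ n, x ∈ E n
  codeE : ∀ n, E n → ℕ
  computable_E : UniformlyComputableFields codeE
  /-- The embeddings `F → E n`, `E n → K`, `E n → E (n + 1)` are uniformly computable. -/
  computable_toE : UniformlyComputableMaps
    (fun _ => (Coded.code : F → ℕ)) codeE (fun n => algebraMap F (E n))
  computable_ofE : UniformlyComputableMaps
    codeE (fun _ => (Coded.code : K → ℕ)) (fun n => ((↑) : E n → K))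
  computable_inclusion : UniformlyComputableMaps
    codeE (fun n => codeE (n + 1)) (fun n => IntermediateField.inclusion (E_lt n).le)
  codeG : ∀ n, (E n ≃ₐ[F] E n) → ℕ
  computable_G : UniformlyComputableFiniteGroups codeG
  /-- The restriction maps `G m → G n` for `n < m` are uniformly computable. -/
  computable_restrict : ∃ r : ℕ → ℕ → ℕ → ℕ,
    Computable (fun t : ℕ × ℕ × ℕ => r t.1 t.2.1 t.2.2) ∧
    ∀ m n, n < m → ∀ (g : E m ≃ₐ[F] E m) (h : E n ≃ₐ[F] E n),
      (∀ (x : E n) (y : E m), (x : K) = y → (h x : K) = g y) → r m n (codeG m g) = codeG n h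
  /-- The actions of `G n` on `E n` are uniformly computable. -/
  computable_action : UniformlyComputableOps codeG codeE codeE (fun _ g x => g x)

/-! ### Hyper-automorphisms -/

open CohPow

/-- The hyper-automorphism group of the tree of hyper-tuples: the automorphisms of `∏_C T_A`, with
its extension order and its concatenation, that preserve the arity. -/
def HAutTree (C : Set ℕ) (A : Type u) [Numbered A] : Subgroup (Equiv.Perm (CohPow C (List A))) where
  carrier := {σ |
    (∀ a b, Holds₂ (fun s t : List A => s <+: t) (σ a) (σ b) ↔ Holds₂ (fun s t => s <+: t) a b) ∧
    (∀ a b c, Holds₃ (fun s t u : List A => s ++ t = u) (σ a) (σ b) (σ c) ↔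
      Holds₃ (fun s t u => s ++ t = u) a b c) ∧
    ∀ a, arity (σ a) = arity a}
  one_mem' := by simp
  mul_mem' := by
    rintro σ τ ⟨h₁, h₂, h₃⟩ ⟨h₁', h₂', h₃'⟩
    refine ⟨fun a b => ?_, fun a b c => ?_, fun a => ?_⟩
    · rw [Equiv.Perm.mul_apply, Equiv.Perm.mul_apply, h₁, h₁']
    · rw [Equiv.Perm.mul_apply, Equiv.Perm.mul_apply, Equiv.Perm.mul_apply, h₂, h₂']
    · rw [Equiv.Perm.mul_apply, h₃, h₃']
  inv_mem' := by
    rintro σ ⟨h₁, h₂, h₃⟩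
    refine ⟨fun a b => ?_, fun a b c => ?_, fun a => ?_⟩
    · rw [← h₁]; simp
    · rw [← h₂]; simp
    · rw [← h₃]; simp

/-- The number of variables of `p`: the least `n` with `p ∈ ℤ[x₀, …, xₙ₋₁]`. -/
def polyVar (p : MvPolynomial ℕ ℤ) : ℕ := p.vars.sup (· + 1)

/-- The graph of the evaluation of integral polynomials at tuples, with values considered as
`1`-tuples: `p(s)` is defined if the arity of `s` is the number of variables of `p`. -/
def PolyEval {K : Type u} [Field K] (p : MvPolynomial ℕ ℤ) (s t : List K) : Prop :=
  polyVar p = s.length ∧ t = [MvPolynomial.aeval (fun j => s.getD j 0) p]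

/-- The hyper-automorphism group of `∏_C K`: the hyper-automorphisms of the tree of hyper-tuples
that preserve all integral hyper-polynomials, that is, `p(a) = b` if and only if
`p(σ a) = σ b`. -/
def HAutField (C : Set ℕ) (K : Type u) [Field K] [Numbered K] :
    Subgroup (Equiv.Perm (CohPow C (List K))) where
  carrier := {σ | σ ∈ HAutTree C K ∧ ∀ (p : CohPow C (MvPolynomial ℕ ℤ)) a b,
    Holds₃ PolyEval p (σ a) (σ b) ↔ Holds₃ PolyEval p a b}
  one_mem' := ⟨one_mem _, by simp⟩
  mul_mem' := by
    rintro σ τ ⟨h, h₁⟩ ⟨h', h₂⟩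
    refine ⟨mul_mem h h', fun p a b => ?_⟩
    rw [Equiv.Perm.mul_apply, Equiv.Perm.mul_apply, h₁, h₂]
  inv_mem' := by
    rintro σ ⟨h, h₁⟩
    refine ⟨inv_mem h, fun p a b => ?_⟩
    rw [← h₁]; simp

/-- The hyper-automorphism group of `∏_C K` over `∏_C F`: the hyper-automorphisms of `∏_C K` that
fix all hyper-tuples of elements of `F`. -/
def HAut (C : Set ℕ) (F : Type u) (K : Type v) [Field F] [Field K] [Algebra F K]
    [Numbered F] [Numbered K] : Subgroup (Equiv.Perm (CohPow C (List K))) where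
  carrier := {σ | σ ∈ HAutField C K ∧ ∀ (a : CohPow C (List F)) (b : CohPow C (List K)),
    Holds₂ (fun s t => s.map (algebraMap F K) = t) a b → σ b = b}
  one_mem' := ⟨one_mem _, by simp⟩
  mul_mem' := by
    rintro σ τ ⟨h, h₁⟩ ⟨h', h₂⟩
    refine ⟨mul_mem h h', fun a b hab => ?_⟩
    rw [Equiv.Perm.mul_apply, h₂ a b hab, h₁ a b hab]
  inv_mem' := by
    rintro σ ⟨h, h₁⟩
    refine ⟨inv_mem h, fun a b hab => ?_⟩
    rw [Equiv.Perm.inv_eq_iff_eq, h₁ a b hab]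

namespace FullyComputableGalois

variable {F : Type u} {K : Type v} [Field F] [Field K] [Algebra F K] [Coded F] [Coded K]
  (P : FullyComputableGalois F K) {C : Set ℕ}

/-- The subset `∏_{C,N} E_i` of `∏_C K`, for `N` in `∏_C ℕ`: the elements `[φ]` that are given by a
partial computable function with values in `E (N i)`, with respect to the presentation of
`E (N i)`. -/
def hyperSubfield (N : CohPow C ℕ) : Set (CohPow C K) :=
  {x | ∃ (ν : CohFun C ℕ) (φ : CohFun C K) (ψ : ℕ →. ℕ), CohPow.mk ν = N ∧ CohPow.mk φ = x ∧ Partrec ψ ∧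
    ∀ᶠ i in almost C, ∃ n ∈ ν.toFun i, ∃ y : P.E n, P.codeE n y ∈ ψ i ∧ (y : K) ∈ φ.toFun i}

/-- The restrictions of `σ` and `τ` to `∏_{C,N} E_i` are different. -/
def DifferAt (σ τ : HAut C F K) (N : CohPow C ℕ) : Prop :=
  ∃ x ∈ P.hyperSubfield N, σ.1 (single x) ≠ τ.1 (single x)

open Classical in
/-- The hyper-distance on `HAut (∏_C K / ∏_C F)`, with values in `∏_C ℚ`: it is `0` if `σ = τ`, and
otherwise `1 / 2 ^ N`, where `N` is least such that `σ` and `τ` differ on `∏_{C,N} E_i`. (The last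
case of the definition does not occur.) -/
def hyperDist (σ τ : HAut C F K) : CohPow C ℚ :=
  if σ = τ then const C 0
  else if h : ∃ N, IsLeast {N | P.DifferAt σ τ N} N then twoPowNeg h.choose
  else const C 0

/-- The infinitesimals of `HAut (∏_C K / ∏_C F)`: the hyper-automorphisms whose hyper-distance from
the identity is infinitesimal, that is, the identity and those at distance `1 / 2 ^ N` for a
non-standard `N`. -/
def INF (C : Set ℕ) : Set (HAut C F K) :=
  {σ | σ = 1 ∨ ∃ N : CohPow C ℕ, N ∉ Set.range (const C) ∧ P.hyperDist 1 σ = twoPowNeg N}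

open Classical in
/-- The distance on `Gal(K/F)`: it is `0` if `σ = τ`, and otherwise `1 / 2 ^ n`, where `n` is least
such that `σ` and `τ` differ on `E n`. -/
def galDist (σ τ : K ≃ₐ[F] K) : ℚ :=
  if σ = τ then 0 else 1 / 2 ^ sInf {n : ℕ | ∃ x ∈ P.E n, σ x ≠ τ x}

end FullyComputableGalois

end

/-!
A hyper-automorphism `σ` acts on hyper-tuples entry by entry, at non-standard places as well
(`HAut.entry_apply`), because it preserves concatenation, the prefix order and the arity. It is
therefore determined by its values on `∏_C K` (`HAut.ext_single`). Since it preserves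
hyper-polynomials and fixes hyper-tuples of elements of `F`, it commutes with the evaluation of
polynomials over `F`, even of non-standard degree (`HAut.horner_apply`).

*Restriction to `K`.* For `x` in `K`, the image `σ x` is a sequence of roots of the minimal
polynomial of `x` over `F`. There are finitely many of them, so cohesiveness makes the sequence
constant (`HAut.exists_apply_const`), and restriction is a homomorphism `HAut.restrict` into
`Gal(K/F)`. The subgroup `I` is its kernel and `D` is its range.

*The hyper-distance.* A primitive element `θ n` of `E n` over `F` can be computed from `n`: one
searches for an element with as many conjugates under `G n` as `G n` has elements. Every element of
`∏_{C,N} E_i` is a hyper-polynomial over `F` in `[θ_{N(i)}]`, with coefficients found by a search.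
Hence `σ` and `τ` differ on `∏_{C,N} E_i` if and only if they differ at `[θ_{N(i)}]`
(`FullyComputableGalois.differAt_iff`). If they differ there for `N = M`, then they map the
hyper-tuple `(θ_0, …, θ_{M(i)})` to different hyper-tuples, and the first place where the images
differ is the least `N` (`FullyComputableGalois.exists_isLeast_differAt`). On a standard `E n`, two
hyper-automorphisms differ exactly if their restrictions to `K` do
(`FullyComputableGalois.differAt_const_iff`). As the standard numbers are an initial segment of
`∏_C ℕ`, this identifies the infinitesimals with the kernel of restriction and gives the isometry.

*Density.* An automorphism of `E n` is extended step by step to `E (n + 1)`, `E (n + 2)`, …, each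
time by a search for an element of the finite Galois group with the right restriction. The limit is
a computable automorphism of `K/F` with computable inverse
(`FullyComputableGalois.exists_computable_algEquiv`), and it acts entrywise on hyper-tuples.

Elements of cohesive powers are handled through `CohPow.val`, which picks a representing sequence,
so that all relations become statements about almost every `i`.
-/

noncomputable section

universe u v w

/-! ### Recursively enumerable predicates -/

section RE

variable {α β σ : Type*} [Primcodable α] [Primcodable β] [Primcodable σ]

theorem REPred.and {p q : α → Prop} (hp : REPred p) (hq : REPred q) :
    REPred fun a => p a ∧ q a := by
  have : Partrec fun a => (Part.assert (p a) fun _ => Part.some ()).bind fun _ =>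
      Part.assert (q a) fun _ => Part.some () :=
    Partrec.bind hp (Partrec.comp hq Computable.fst)
  refine Partrec.of_eq this fun a => Part.ext fun b => ?_
  simp [Part.mem_assert_iff]

theorem REPred.comp {p : β → Prop} (hp : REPred p) {f : α → β} (hf : Computable f) :
    REPred fun a => p (f a) :=
  Partrec.comp hp hf

theorem REPred.mem {f : α →. β} (hf : Partrec f) {g : α → β} (hg : Computable g) :
    REPred fun a => g a ∈ f a := by
  classical
  have h : Partrec fun a => (f a).bind fun b =>
      ((if Encodable.encode b = Encodable.encode (g a) then some () else none : Option Unit) :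
        Part Unit) := by
    refine Partrec.bind hf (Computable.ofOption ?_)
    have hc : Computable fun t : α × β =>
        decide (Encodable.encode t.2 = Encodable.encode (g t.1)) :=
      (Primrec.eq.decide.to_comp).comp (Computable.encode.comp Computable.snd)
        (Computable.encode.comp (hg.comp Computable.fst))
    exact (Computable.cond hc (Computable.const (some ())) (Computable.const none)).of_eq
      fun t => by by_cases h : Encodable.encode t.2 = Encodable.encode (g t.1) <;> simp [h]
  refine (Partrec.dom_re h).of_eq fun a => ?_
  constructor
  · rintro ⟨h₁, h₂⟩
    have := Part.get_mem h₁
    by_cases h : Encodable.encode ((f a).get h₁) = Encodable.encode (g a)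
    · rwa [Encodable.encode_injective h] at this
    · simp [h] at h₂
  · intro h
    have := Part.eq_some_iff.2 h
    rw [this]
    simp

theorem REPred.eq {f g : α → β} (hf : Computable f) (hg : Computable g) :
    REPred fun a => f a = g a :=
  (REPred.mem (f := fun a => Part.some (g a)) hg.partrec hf).of_eq fun a => by simp

/-- An r.e. predicate is the projection of a decidable one. -/
theorem REPred.exists_computable {p : α → Prop} (hp : REPred p) :
    ∃ q : α → ℕ → Bool, Computable₂ q ∧ ∀ a, p a ↔ ∃ k, q a k = true := by
  obtain ⟨c, hc⟩ := Nat.Partrec.Code.exists_code.1 hp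
  refine ⟨fun a k => (Nat.Partrec.Code.evaln k c (Encodable.encode a)).isSome, ?_, fun a => ?_⟩
  · exact (Primrec.option_isSome.comp (Nat.Partrec.Code.primrec_evaln.comp
      ((Primrec.snd.pair (Primrec.const c)).pair (Primrec.encode.comp Primrec.fst)))).to_comp
  · have h : (Nat.Partrec.Code.eval c (Encodable.encode a)).Dom ↔ p a := by
      rw [hc]
      simp [Part.assert]
    rw [← h, Part.dom_iff_mem]
    simp only [Nat.Partrec.Code.evaln_complete, Option.isSome_iff_exists]
    exact exists_comm

/-- Uniformization: an r.e. relation contains the graph of a partial computable function with the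
same domain. -/
theorem REPred.exists_partrec {p : α × β → Prop} (hp : REPred p) :
    ∃ f : α →. β, Partrec f ∧ (∀ a b, b ∈ f a → p (a, b)) ∧ ∀ a b, p (a, b) → (f a).Dom := by
  obtain ⟨q, hq, h⟩ := hp.exists_computable
  let s : α → ℕ → Option β := fun a n =>
    (Encodable.decode (α := β) n.unpair.1).bind fun b =>
      bif q (a, b) n.unpair.2 then some b else none
  have hs : Computable₂ s := by
    refine Computable.option_bind
      (Computable.decode.comp (Computable.fst.comp (Computable.unpair.comp Computable.snd))) ?_
    refine Computable.cond (hq.comp ?_ ?_) ?_ (Computable.const none)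
    · exact (Computable.fst.comp Computable.fst).pair Computable.snd
    · exact Computable.snd.comp (Computable.unpair.comp (Computable.snd.comp Computable.fst))
    · exact Computable.option_some.comp Computable.snd
  refine ⟨fun a => Nat.rfindOpt (s a), Partrec.rfindOpt hs, fun a b hb => ?_, fun a b hb => ?_⟩
  · obtain ⟨n, hn⟩ := Nat.rfindOpt_spec hb
    obtain ⟨b', -, hb'⟩ := Option.bind_eq_some_iff.1 (Option.mem_def.1 hn)
    cases hc : q (a, b') n.unpair.2 with
    | false => simp [hc] at hb'
    | true =>
      simp only [hc, cond_true, Option.some.injEq] at hb'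
      subst hb'
      exact (h _).2 ⟨_, hc⟩
  · obtain ⟨k, hk⟩ := (h _).1 hb
    exact Nat.rfindOpt_dom.2 ⟨Nat.pair (Encodable.encode b) k, b, by simp [s, hk]⟩

theorem REPred.exists {p : α × β → Prop} (hp : REPred p) : REPred fun a => ∃ b, p (a, b) := by
  obtain ⟨f, hf, h, h'⟩ := hp.exists_partrec
  exact (Partrec.dom_re hf).of_eq fun a =>
    ⟨fun hd => ⟨_, h a _ (Part.get_mem hd)⟩, fun ⟨b, hb⟩ => h' a b hb⟩

theorem ComputablePred.comp {p : β → Prop} (hp : ComputablePred p) {f : α → β}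
    (hf : Computable f) : ComputablePred fun a => p (f a) := by
  obtain ⟨b, hb, rfl⟩ := ComputablePred.computable_iff.1 hp
  exact ComputablePred.computable_iff.2 ⟨_, hb.comp hf, rfl⟩

/-- A computable choice function for an r.e. relation that is total on a decidable set. -/
theorem exists_computable_choice [Inhabited β] {p : α → Prop} (hp : ComputablePred p)
    {S : α × β → Prop} (hS : REPred S) (h : ∀ a, p a → ∃ b, S (a, b)) :
    ∃ f : α → β, Computable f ∧ ∀ a, p a → S (a, f a) := by
  obtain ⟨c, hc, rfl⟩ := ComputablePred.computable_iff.1 hp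
  obtain ⟨f, hf, hfS, hfd⟩ := hS.exists_partrec
  have hP : Partrec fun a => bif c a then f a else Part.some default :=
    Partrec.cond hc hf (Computable.const default).partrec
  have hd : ∀ a, (bif c a then f a else Part.some default).Dom := fun a => by
    cases hca : c a with
    | false => trivial
    | true =>
      obtain ⟨b, hb⟩ := h a hca
      exact hfd a b hb
  refine ⟨fun a => (bif c a then f a else Part.some default).get (hd a),
    hP.of_eq_tot fun a => Part.get_mem _, fun a ha => hfS a _ ?_⟩
  have ha' : (bif c a then f a else Part.some default) = f a := by
    have : c a = true := ha
    simp [this]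
  rw [← ha']
  exact Part.get_mem _

/-! ### Computable operations on lists -/

theorem Computable.list_foldl {f : α → List β} {g : α → σ} {h : α → σ × β → σ}
    (hf : Computable f) (hg : Computable g) (hh : Computable₂ h) :
    Computable fun a => (f a).foldl (fun s b => h a (s, b)) (g a) := by
  have hrec : Computable fun a => Nat.rec (motive := fun _ => σ) (g a)
      (fun k s => Option.casesOn (motive := fun _ => σ) (f a)[k]? s fun b => h a (s, b))
      (f a).length := by
    refine Computable.nat_rec (h := fun a (t : ℕ × σ) =>
      Option.casesOn (motive := fun _ => σ) (f a)[t.1]? t.2 fun b => h a (t.2, b))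
      (Computable.list_length.comp hf) hg ?_
    refine Computable.option_casesOn (o := fun t : α × (ℕ × σ) => (f t.1)[t.2.1]?)
      (f := fun t => t.2.2) (g := fun t b => h t.1 (t.2.2, b)) ?_ ?_ ?_
    · exact Computable.list_getElem?.comp (hf.comp Computable.fst)
        (Computable.fst.comp Computable.snd)
    · exact Computable.snd.comp Computable.snd
    · exact hh.comp (Computable.fst.comp Computable.fst)
        ((Computable.snd.comp (Computable.snd.comp Computable.fst)).pair Computable.snd)
  refine hrec.of_eq fun a => ?_
  suffices H : ∀ n, n ≤ (f a).length → Nat.rec (motive := fun _ => σ) (g a)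
      (fun k s => Option.casesOn (motive := fun _ => σ) (f a)[k]? s fun b => h a (s, b)) n =
      ((f a).take n).foldl (fun s b => h a (s, b)) (g a) by
    simpa using H _ le_rfl
  intro n hn
  induction n with
  | zero => simp
  | succ n ih =>
    rw [List.take_succ_eq_append_getElem (by omega), List.foldl_append, ← ih (by omega)]
    simp [List.getElem?_eq_getElem (show n < (f a).length by omega)]

theorem Computable.list_foldr {f : α → List β} {g : α → σ} {h : α → β × σ → σ}
    (hf : Computable f) (hg : Computable g) (hh : Computable₂ h) :
    Computable fun a => (f a).foldr (fun b s => h a (b, s)) (g a) :=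
  (Computable.list_foldl (h := fun a t => h a (t.2, t.1)) (Computable.list_reverse.comp hf) hg
    (hh.comp Computable.fst ((Computable.snd.comp Computable.snd).pair
      (Computable.fst.comp Computable.snd)))).of_eq fun a => by simp

theorem Computable.list_map {f : α → List β} {g : α → β → σ} (hf : Computable f)
    (hg : Computable₂ g) : Computable fun a => (f a).map (g a) :=
  (Computable.list_foldr (h := fun a t => g a t.1 :: t.2) hf (Computable.const [])
    (Computable.list_cons.comp (hg.comp Computable.fst (Computable.fst.comp Computable.snd))
      (Computable.snd.comp Computable.snd))).of_eq fun a => by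
        generalize f a = l
        induction l <;> simp_all

theorem ComputablePred.forall_mem_list {f : α → List β} {p : α × β → Prop} (hf : Computable f)
    (hp : ComputablePred p) : ComputablePred fun a => ∀ b ∈ f a, p (a, b) := by
  obtain ⟨c, hc, rfl⟩ := ComputablePred.computable_iff.1 hp
  refine ComputablePred.computable_iff.2 ⟨fun a => (f a).foldr (fun b s => c (a, b) && s) true,
    Computable.list_foldr (h := fun a t => c (a, t.1) && t.2) hf (Computable.const true)
      (Primrec.and.to_comp.comp (hc.comp (Computable.fst.pair
        (Computable.fst.comp Computable.snd))) (Computable.snd.comp Computable.snd)), ?_⟩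
  funext a
  show (∀ b ∈ f a, c (a, b) = true) = ((f a).foldr (fun b s => c (a, b) && s) true = true)
  generalize f a = l
  induction l <;> simp_all

theorem primrecPred_nodup : PrimrecPred (List.Nodup : List ℕ → Prop) := by
  have h : PrimrecRel fun (j : ℕ) (l : List ℕ) => l.idxOf (l.getD j 0) = j :=
    Primrec.eq.comp (Primrec.list_idxOf.comp ((Primrec.list_getD 0).comp Primrec.snd Primrec.fst)
      Primrec.snd) Primrec.fst
  refine (h.forall_mem_list.comp (Primrec.list_range.comp Primrec.list_length)
    Primrec.id).of_eq fun l => ?_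
  simp only [List.mem_range]
  constructor
  · intro H
    rw [List.nodup_iff_injective_getElem]
    rintro ⟨i, hi⟩ ⟨j, hj⟩ hij
    have h₁ := H i hi
    have h₂ := H j hj
    simp only [id, List.getD_eq_getElem _ _ hi, List.getD_eq_getElem _ _ hj] at h₁ h₂ hij
    rw [hij] at h₁
    exact Fin.ext (h₁.symm.trans h₂)
  · intro H j hj
    simp only [id, List.getD_eq_getElem _ _ hj]
    exact H.idxOf_getElem j hj

end RE

/-! ### Elements of cohesive powers as sequences -/

theorem IsCohesive.neBot {C : Set ℕ} (hC : IsCohesive C) : (almost C).NeBot := by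
  refine ⟨fun h => hC.1 ?_⟩
  have : ∀ᶠ i in almost C, False := by rw [h]; trivial
  simpa using eventually_almost_iff.1 this

theorem IsCohesive.eventually_or {C : Set ℕ} (hC : IsCohesive C) {W : ℕ → Prop}
    (hW : REPred W) : (∀ᶠ i in almost C, W i) ∨ ∀ᶠ i in almost C, ¬ W i := by
  simpa only [eventually_almost_iff, not_not] using hC.2 W hW

/-- Every element of `A` has exactly one name, the number that encodes `k a`. -/
def IsKey {A : Type u} [Numbered A] {α : Type*} [Primcodable α] (k : A → α) : Prop :=
  ∀ n a, Numbered.Names n a ↔ Encodable.encode (k a) = n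

theorem isKey_code {A : Type u} [Coded A] : IsKey (Coded.code : A → ℕ) := fun _ _ => Iff.rfl

theorem isKey_id : IsKey (id : ℕ → ℕ) := fun _ _ => Iff.rfl

theorem isKey_list {A : Type u} [Coded A] :
    IsKey (List.map Coded.code : List A → List ℕ) := by
  intro n l
  have h : ∀ ns : List ℕ, List.Forall₂ Numbered.Names ns l ↔ l.map Coded.code = ns := by
    induction l with
    | nil => intro ns; simp [eq_comm]
    | cons a l ih =>
      intro ns
      cases ns with
      | nil => simp
      | cons m ns =>
        rw [List.forall₂_cons, ih]
        simp only [List.map_cons, List.cons.injEq]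
        rfl
  constructor
  · rintro ⟨ns, rfl, hns⟩
    rw [(h ns).1 hns]
  · intro hn
    exact ⟨_, hn, (h _).2 rfl⟩

namespace IsKey

variable {A : Type u} [Numbered A] {α : Type*} [Primcodable α] {k : A → α}

theorem injective (hk : IsKey k) : Function.Injective k := fun a b h =>
  Numbered.functional ((hk (Encodable.encode (k a)) a).2 rfl) ((hk _ b).2 (by rw [h]))

/-- The graph of a partial computable function is r.e. -/
theorem rePred_graph (hk : IsKey k) {C : Set ℕ} (φ : CohFun C A) :
    REPred fun t : ℕ × α => ∃ a ∈ φ.toFun t.1, k a = t.2 := by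
  obtain ⟨ψ, hψ, h⟩ := φ.computable
  refine (REPred.mem (f := fun t : ℕ × α => ψ t.1) (hψ.comp Computable.fst)
    (Computable.encode.comp Computable.snd)).of_eq ?_
  rintro ⟨i, x⟩
  constructor
  · intro hx
    have hd := (h i).1.1 (Part.dom_iff_mem.2 ⟨_, hx⟩)
    refine ⟨_, Part.get_mem hd, Encodable.encode_injective ?_⟩
    exact (hk _ _).1 ((h i).2 _ hx _ (Part.get_mem hd))
  · rintro ⟨a, ha, rfl⟩
    have hd := (h i).1.2 (Part.dom_iff_mem.2 ⟨_, ha⟩)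
    have := (hk _ _).1 ((h i).2 _ (Part.get_mem hd) _ ha)
    simp only [this]
    exact Part.get_mem hd

end IsKey

namespace CohPow

variable {C : Set ℕ} {A : Type u} {B : Type v} {D : Type w} [Numbered A] [Numbered B] [Numbered D]
  [Nonempty A] [Nonempty B] [Nonempty D]

open Classical in
/-- A sequence representing the element `x` of the cohesive power: a representative of the class
`x`, with an arbitrary value at the places where it is not defined. Only the values for almost
every `i` matter. -/
def val (x : CohPow C A) (i : ℕ) : A :=
  if h : (x.out.toFun i).Dom then (x.out.toFun i).get h else Classical.arbitrary A

theorem val_mk (φ : CohFun C A) : ∀ᶠ i in almost C, (mk φ).val i ∈ φ.toFun i := by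
  have h : mk (mk φ).out = mk φ := Quotient.out_eq _
  filter_upwards [mk_eq_mk.1 h] with i ⟨a, ha, ha'⟩
  have hd : ((mk φ).out.toFun i).Dom := Part.dom_iff_mem.2 ⟨a, ha⟩
  rw [val, dif_pos hd, Part.get_eq_of_mem ha hd]
  exact ha'

theorem exists_rep (x : CohPow C A) :
    ∃ φ : CohFun C A, mk φ = x ∧ ∀ᶠ i in almost C, x.val i ∈ φ.toFun i := by
  obtain ⟨φ, rfl⟩ : ∃ φ, mk φ = x := Quotient.exists_rep x
  exact ⟨φ, rfl, val_mk φ⟩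

theorem ext_val {x y : CohPow C A} : x = y ↔ ∀ᶠ i in almost C, x.val i = y.val i := by
  constructor
  · rintro rfl
    exact Eventually.of_forall fun _ => rfl
  · obtain ⟨φ, rfl, hφ⟩ := x.exists_rep
    obtain ⟨ψ, rfl, hψ⟩ := y.exists_rep
    intro h
    refine mk_eq_mk.2 ?_
    filter_upwards [hφ, hψ, h] with i h₁ h₂ h₃
    exact ⟨_, h₁, h₃ ▸ h₂⟩

theorem holds₂_iff {R : A → B → Prop} {x : CohPow C A} {y : CohPow C B} :
    Holds₂ R x y ↔ ∀ᶠ i in almost C, R (x.val i) (y.val i) := by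
  obtain ⟨φ, rfl, hφ⟩ := x.exists_rep
  obtain ⟨ψ, rfl, hψ⟩ := y.exists_rep
  rw [holds₂_mk]
  constructor <;> intro h <;> filter_upwards [hφ, hψ, h] with i h₁ h₂ h₃
  · obtain ⟨a, ha, b, hb, hR⟩ := h₃
    rwa [Part.mem_unique h₁ ha, Part.mem_unique h₂ hb]
  · exact ⟨_, h₁, _, h₂, h₃⟩

theorem holds₃_iff {R : A → B → D → Prop} {x : CohPow C A} {y : CohPow C B} {z : CohPow C D} :
    Holds₃ R x y z ↔ ∀ᶠ i in almost C, R (x.val i) (y.val i) (z.val i) := by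
  obtain ⟨φ, rfl, hφ⟩ := x.exists_rep
  obtain ⟨ψ, rfl, hψ⟩ := y.exists_rep
  obtain ⟨χ, rfl, hχ⟩ := z.exists_rep
  rw [holds₃_mk]
  constructor <;> intro h <;> filter_upwards [hφ, hψ, hχ, h] with i h₁ h₂ h₃ h₄
  · obtain ⟨a, ha, b, hb, d, hd, hR⟩ := h₄
    rwa [Part.mem_unique h₁ ha, Part.mem_unique h₂ hb, Part.mem_unique h₃ hd]
  · exact ⟨_, h₁, _, h₂, _, h₃, h₄⟩

theorem le_iff {M N : CohPow C ℕ} : M ≤ N ↔ ∀ᶠ i in almost C, M.val i ≤ N.val i :=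
  holds₂_iff

theorem val_const (a : A) : ∀ᶠ i in almost C, (const C a).val i = a := by
  obtain ⟨φ, hφ⟩ : ∃ φ : CohFun C A, const C a = mk φ ∧ φ.toFun = fun _ => Part.some a :=
    ⟨_, rfl, rfl⟩
  rw [hφ.1]
  filter_upwards [val_mk φ] with i hi
  rw [hφ.2] at hi
  exact Part.mem_some_iff.1 hi

theorem val_map (f : A → B) (hf) (x : CohPow C A) :
    ∀ᶠ i in almost C, (map f hf x).val i = f (x.val i) := by
  obtain ⟨φ, rfl, hφ⟩ := x.exists_rep
  filter_upwards [hφ, val_mk (C := C) (A := B) _] with i hi h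
  exact Part.mem_unique h (Part.mem_map f hi)

theorem map_injective {f : A → B} (hf) (h : Function.Injective f) :
    Function.Injective (map (C := C) f hf) := by
  intro x y hxy
  rw [ext_val] at hxy ⊢
  filter_upwards [hxy, val_map f hf x, val_map f hf y] with i h₁ h₂ h₃
  exact h (by rw [← h₂, ← h₃, h₁])

theorem map_const (f : A → B) (hf) (a : A) : map f hf (const C a) = const C (f a) := by
  rw [ext_val]
  filter_upwards [val_map f hf (const C a), val_const (C := C) a, val_const (C := C) (f a)] with i
    h₁ h₂ h₃
  rw [h₁, h₂, h₃]

theorem val_single (x : CohPow C A) : ∀ᶠ i in almost C, (single x).val i = [x.val i] :=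
  val_map _ _ x

theorem val_arity (x : CohPow C (List A)) :
    ∀ᶠ i in almost C, (arity x).val i = (x.val i).length :=
  val_map _ _ x

theorem single_injective : Function.Injective (single : CohPow C A → CohPow C (List A)) :=
  map_injective _ fun _ _ h => by simpa using h

theorem twoPowNeg_injective : Function.Injective (twoPowNeg : CohPow C ℕ → CohPow C ℚ) := by
  intro M N hMN
  unfold twoPowNeg at hMN
  refine map_injective _ (fun m n h => ?_) hMN
  have h' : (2 : ℚ) ^ m = 2 ^ n := by simpa using h
  exact pow_right_injective₀ (by norm_num) (by norm_num) h'

theorem const_inj (hC : IsCohesive C) {a b : A} : const C a = const C b ↔ a = b := by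
  refine ⟨fun h => ?_, fun h => h ▸ rfl⟩
  have := hC.neBot
  obtain ⟨i, h₁, h₂, h₃⟩ :=
    ((ext_val.1 h).and ((val_const (C := C) a).and (val_const (C := C) b))).exists
  rw [← h₂, h₁, h₃]

section Key

variable {α β δ : Type*} [Primcodable α] [Primcodable β] [Primcodable δ] {kA : A → α} {kB : B → β}
  {kD : D → δ}

/-- If an r.e. condition on `i` and the key of an unknown element has a solution for almost every
`i`, then an element of the cohesive power solves it. -/
theorem exists_val (hD : IsKey kD) {S : ℕ × δ → Prop} (hS : REPred S)
    (hk : ∀ i n, S (i, n) → ∃ d, kD d = n) (h : ∀ᶠ i in almost C, ∃ n, S (i, n)) :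
    ∃ z : CohPow C D, ∀ᶠ i in almost C, S (i, kD (z.val i)) := by
  obtain ⟨f, hf, hfS, hfd⟩ := hS.exists_partrec
  choose d hd using fun i (hi : (f i).Dom) => hk i _ (hfS i _ (Part.get_mem hi))
  let φ : CohFun C D :=
    { toFun := fun i => ⟨(f i).Dom, d i⟩
      computable := by
        refine ⟨fun i => (f i).map Encodable.encode,
          hf.map (Computable.encode.comp Computable.snd), fun i => ⟨Iff.rfl, ?_⟩⟩
        rintro n hn a ⟨hi, rfl⟩
        obtain ⟨m, hm, rfl⟩ := (Part.mem_map_iff _).1 hn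
        rw [hD]
        show Encodable.encode (kD (d i hi)) = _
        rw [hd, Part.get_eq_of_mem hm]
      dom := h.mono fun i ⟨n, hn⟩ => hfd i n hn }
  refine ⟨mk φ, (val_mk φ).mono ?_⟩
  rintro i ⟨hi, hi'⟩
  rw [← hi']
  show S (i, kD (d i hi))
  rw [hd]
  exact hfS i _ (Part.get_mem (o := f i) hi)

/-- An r.e. relation between the values of `x`, `y` and an unknown that has a solution for almost
every `i` is solved by an element of the cohesive power. -/
theorem exists_of_re (hA : IsKey kA) (hB : IsKey kB) (hD : IsKey kD) {R : A → B → D → Prop}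
    {S : α × β × δ → Prop} (hS : REPred S)
    (hR : ∀ a b n, S (kA a, kB b, n) ↔ ∃ d, kD d = n ∧ R a b d) (x : CohPow C A) (y : CohPow C B)
    (h : ∀ᶠ i in almost C, ∃ d, R (x.val i) (y.val i) d) :
    ∃ z : CohPow C D, ∀ᶠ i in almost C, R (x.val i) (y.val i) (z.val i) := by
  obtain ⟨φ, -, hφ⟩ := x.exists_rep
  obtain ⟨ψ, -, hψ⟩ := y.exists_rep
  let T : (ℕ × δ) × α × β → Prop := fun t => (∃ a ∈ φ.toFun t.1.1, kA a = t.2.1) ∧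
    (∃ b ∈ ψ.toFun t.1.1, kB b = t.2.2) ∧ S (t.2.1, t.2.2, t.1.2)
  have hT : REPred T := by
    refine REPred.and ((hA.rePred_graph φ).comp (f := fun t : (ℕ × δ) × α × β => (t.1.1, t.2.1)) ?_)
      (REPred.and ((hB.rePred_graph ψ).comp (f := fun t : (ℕ × δ) × α × β => (t.1.1, t.2.2)) ?_)
        (hS.comp (f := fun t : (ℕ × δ) × α × β => (t.2.1, t.2.2, t.1.2)) ?_))
    · exact (Computable.fst.comp Computable.fst).pair (Computable.fst.comp Computable.snd)
    · exact (Computable.fst.comp Computable.fst).pair (Computable.snd.comp Computable.snd)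
    · exact (Computable.fst.comp Computable.snd).pair ((Computable.snd.comp Computable.snd).pair
        (Computable.snd.comp Computable.fst))
  obtain ⟨z, hz⟩ := exists_val (C := C) hD hT.exists
    (by
      rintro i n ⟨⟨_, _⟩, ⟨a, -, rfl⟩, ⟨b, -, rfl⟩, hs⟩
      obtain ⟨d, hd, -⟩ := (hR a b n).1 hs
      exact ⟨d, hd⟩)
    (by
      filter_upwards [hφ, hψ, h] with i h₁ h₂ ⟨d, hd⟩
      exact ⟨kD d, (kA (x.val i), kB (y.val i)), ⟨_, h₁, rfl⟩, ⟨_, h₂, rfl⟩,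
        (hR _ _ _).2 ⟨d, rfl, hd⟩⟩)
  refine ⟨z, ?_⟩
  filter_upwards [hφ, hψ, hz] with i h₁ h₂ h₃
  obtain ⟨⟨_, _⟩, ⟨a, ha, rfl⟩, ⟨b, hb, rfl⟩, hs⟩ := h₃
  obtain ⟨d, hd, hRd⟩ := (hR a b _).1 hs
  rw [Part.mem_unique h₁ ha, Part.mem_unique h₂ hb, ← hD.injective hd]
  exact hRd

/-- Partial computable binary operations act on cohesive powers. -/
theorem exists_of_computable (hA : IsKey kA) (hB : IsKey kB) (hD : IsKey kD)
    {f : A → B → Option D} {g : α → β → Option δ} (hg : Computable₂ g)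
    (hfg : ∀ a b, g (kA a) (kB b) = (f a b).map kD) (x : CohPow C A) (y : CohPow C B)
    (h : ∀ᶠ i in almost C, ∃ d, f (x.val i) (y.val i) = some d) :
    ∃ z : CohPow C D, ∀ᶠ i in almost C, f (x.val i) (y.val i) = some (z.val i) := by
  refine exists_of_re hA hB hD (S := fun t => g t.1 t.2.1 = some t.2.2)
    (R := fun a b d => f a b = some d) ?_ (fun a b n => ?_) x y h
  · exact REPred.eq (hg.comp Computable.fst (Computable.fst.comp Computable.snd))
      (Computable.option_some.comp (Computable.snd.comp Computable.snd))
  · simp only [hfg, Option.map_eq_some_iff, and_comm]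

/-- An r.e. relation holds almost everywhere or fails almost everywhere. -/
theorem eventually_or (hC : IsCohesive C) (hA : IsKey kA) (hB : IsKey kB) {R : A → B → Prop}
    {S : α × β → Prop} (hS : REPred S) (hR : ∀ a b, S (kA a, kB b) ↔ R a b) (x : CohPow C A)
    (y : CohPow C B) :
    (∀ᶠ i in almost C, R (x.val i) (y.val i)) ∨ ∀ᶠ i in almost C, ¬ R (x.val i) (y.val i) := by
  obtain ⟨φ, -, hφ⟩ := x.exists_rep
  obtain ⟨ψ, -, hψ⟩ := y.exists_rep
  let T : ℕ × α × β → Prop := fun t => (∃ a ∈ φ.toFun t.1, kA a = t.2.1) ∧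
    (∃ b ∈ ψ.toFun t.1, kB b = t.2.2) ∧ S (t.2.1, t.2.2)
  have hT : REPred T := by
    refine REPred.and ((hA.rePred_graph φ).comp (f := fun t : ℕ × α × β => (t.1, t.2.1)) ?_)
      (REPred.and ((hB.rePred_graph ψ).comp (f := fun t : ℕ × α × β => (t.1, t.2.2)) ?_)
        (hS.comp Computable.snd))
    · exact Computable.fst.pair (Computable.fst.comp Computable.snd)
    · exact Computable.fst.pair (Computable.snd.comp Computable.snd)
  have key : ∀ᶠ i in almost C, (∃ t, T (i, t)) ↔ R (x.val i) (y.val i) := by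
    filter_upwards [hφ, hψ] with i h₁ h₂
    constructor
    · rintro ⟨⟨_, _⟩, ⟨a, ha, rfl⟩, ⟨b, hb, rfl⟩, hs⟩
      rw [Part.mem_unique h₁ ha, Part.mem_unique h₂ hb]
      exact (hR a b).1 hs
    · intro h
      exact ⟨(_, _), ⟨_, h₁, rfl⟩, ⟨_, h₂, rfl⟩, (hR _ _).2 h⟩
  refine (hC.eventually_or hT.exists).imp (fun h => ?_) fun h => ?_
  · filter_upwards [key, h] with i h₁ h₂ using h₁.1 h₂
  · filter_upwards [key, h] with i h₁ h₂ using fun h₃ => h₂ (h₁.2 h₃)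

theorem eventually_ne (hC : IsCohesive C) (hA : IsKey kA) {x y : CohPow C A} (h : x ≠ y) :
    ∀ᶠ i in almost C, x.val i ≠ y.val i :=
  (eventually_or hC hA hA (S := fun t : α × α => t.1 = t.2)
    (REPred.eq Computable.fst Computable.snd) (fun _ _ => hA.injective.eq_iff) x y).resolve_left
      fun h' => h (ext_val.2 h')

/-- An element of the cohesive power with values in a finite set is standard. -/
theorem exists_eq_const (hC : IsCohesive C) (hA : IsKey kA) {x : CohPow C A} {T : Set A}
    (hT : T.Finite) (h : ∀ᶠ i in almost C, x.val i ∈ T) : ∃ a ∈ T, x = const C a := by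
  by_contra! hne
  have h' : ∀ᶠ i in almost C, ∀ a ∈ T, x.val i ≠ a := by
    rw [Filter.eventually_all_finite hT]
    intro a ha
    filter_upwards [eventually_ne hC hA (hne a ha), val_const (C := C) a] with i h₁ h₂
    rwa [← h₂]
  have := hC.neBot
  obtain ⟨i, h₁, h₂⟩ := (h.and h').exists
  exact h₂ _ h₁ rfl

end Key

theorem lt_or_le (hC : IsCohesive C) (M N : CohPow C ℕ) :
    (∀ᶠ i in almost C, M.val i < N.val i) ∨ N ≤ M := by
  rw [le_iff]
  refine (eventually_or hC isKey_id isKey_id (S := fun t : ℕ × ℕ => t.1 < t.2)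
    (R := fun m n => m < n) ?_ (fun _ _ => Iff.rfl) M N).imp id fun h => h.mono fun i hi =>
      not_lt.1 hi
  exact (ComputablePred.to_re (PrimrecPred.computablePred Primrec.nat_lt))

theorem le_antisymm {M N : CohPow C ℕ} (h : M ≤ N) (h' : N ≤ M) : M = N := by
  rw [le_iff] at h h'
  rw [ext_val]
  filter_upwards [h, h'] with i h₁ h₂ using Nat.le_antisymm h₁ h₂

theorem const_le_const (hC : IsCohesive C) {m n : ℕ} : const C m ≤ const C n ↔ m ≤ n := by
  rw [le_iff]
  have := hC.neBot
  constructor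
  · intro h
    obtain ⟨i, h₁, h₂, h₃⟩ :=
      (h.and ((val_const (C := C) m).and (val_const (C := C) n))).exists
    rwa [h₂, h₃] at h₁
  · intro h
    filter_upwards [val_const (C := C) m, val_const (C := C) n] with i h₁ h₂
    rwa [h₁, h₂]

/-- The standard numbers form an initial segment. -/
theorem eq_const_of_le (hC : IsCohesive C) {N : CohPow C ℕ} {n : ℕ} (h : N ≤ const C n) :
    ∃ m, N = const C m := by
  obtain ⟨m, -, hm⟩ := exists_eq_const hC isKey_id (Set.finite_Iic n) (x := N) (by
    filter_upwards [le_iff.1 h, val_const (C := C) n] with i h₁ h₂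
    rwa [h₂] at h₁)
  exact ⟨m, hm⟩

end CohPow

/-! ### The polynomials used to describe hyper-automorphisms -/

/-- The number of variables of `p` is `n + 1` if `p` involves no variable beyond `x_n`, and the
value of `p` at some integers depends on `x_n`. -/
theorem polyVar_eq {p : MvPolynomial ℕ ℤ} {n : ℕ} (h : p ∈ MvPolynomial.supported ℤ {j | j ≤ n})
    {f g : ℕ → ℤ} (hfg : ∀ j ≠ n, f j = g j)
    (hp : MvPolynomial.aeval f p ≠ MvPolynomial.aeval g p) : polyVar p = n + 1 := by
  have h' := MvPolynomial.mem_supported.1 h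
  refine le_antisymm (Finset.sup_le fun j hj => Nat.succ_le_succ (h' hj)) ?_
  refine Finset.le_sup (f := (· + 1)) (?_ : n ∈ p.vars)
  by_contra hn
  refine hp ?_
  refine MvPolynomial.hom_congr_vars
    (f₁ := (MvPolynomial.aeval f : MvPolynomial ℕ ℤ →ₐ[ℤ] ℤ).toRingHom)
    (f₂ := (MvPolynomial.aeval g : MvPolynomial ℕ ℤ →ₐ[ℤ] ℤ).toRingHom) ?_ ?_ rfl
  · ext; simp
  · intro j hj _
    have : j ≠ n := fun h => hn (h ▸ hj)
    simpa using hfg j this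

theorem polyVar_add : polyVar (.X 0 + .X 1) = 2 :=
  polyVar_eq (n := 1) (f := fun _ => 0) (g := fun j => if j = 1 then 1 else 0)
    (add_mem (MvPolynomial.X_mem_supported.2 (by simp)) (MvPolynomial.X_mem_supported.2 (by simp)))
    (fun j hj => by simp [hj]) (by simp)

theorem polyVar_mul : polyVar (.X 0 * .X 1) = 2 :=
  polyVar_eq (n := 1) (f := fun j => if j = 1 then 0 else 1) (g := fun _ => 1)
    (mul_mem (MvPolynomial.X_mem_supported.2 (by simp)) (MvPolynomial.X_mem_supported.2 (by simp)))
    (fun j hj => by simp [hj]) (by simp)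

/-- The list of terms, in the format of `polyOfTerms`, of `x_d + ∑ j < d, x_j * x_d ^ j`. The
exponent lists have length `d + 1`; for `j < d` the exponent of `x_j` is `1` and that of
`x_d` is `j`. -/
def linearFamilyTerms (d : ℕ) : List (ℤ × List ℕ) :=
  (1, (List.range (d + 1)).map fun k => if k = d then 1 else 0) ::
    (List.range d).map fun j =>
      (1, (List.range (d + 1)).map fun k => if k = j then 1 else if k = d then j else 0)

/-- The polynomial `x_d + ∑ j < d, x_j * x_d ^ j`: up to the summand `x_d`, which ensures that `x_d`
occurs, it is the general polynomial of degree less than `d` in `x_d`, with the coefficients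
`x_0, …, x_{d-1}`. -/
def linearFamily (d : ℕ) : MvPolynomial ℕ ℤ := polyOfTerms (linearFamilyTerms d)

/-- The value of a single term with coefficient `1` and exponents `e 0, …, e (n - 1)`. -/
theorem aeval_term {R : Type*} [CommRing R] (g : ℕ → R) (n : ℕ) (e : ℕ → ℕ) :
    MvPolynomial.aeval g (MvPolynomial.C (1 : ℤ) *
      ∏ j ∈ Finset.range ((List.range n).map e).length,
        MvPolynomial.X j ^ ((List.range n).map e).getD j 0) = ∏ j ∈ Finset.range n, g j ^ e j := by
  simp only [map_one, one_mul, map_prod, map_pow, MvPolynomial.aeval_X, List.length_map,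
    List.length_range]
  refine Finset.prod_congr rfl fun j hj => ?_
  rw [List.getD_eq_getElem _ _ (by simpa using hj)]
  simp

theorem aeval_linearFamily {R : Type*} [CommRing R] (g : ℕ → R) (d : ℕ) :
    MvPolynomial.aeval g (linearFamily d) = g d + ∑ j ∈ Finset.range d, g j * g d ^ j := by
  rw [linearFamily, polyOfTerms, map_list_sum, linearFamilyTerms]
  simp only [List.map_cons, List.map_map, List.sum_cons]
  rw [aeval_term]
  congr 1
  · simp
  · have hsum : ∀ (m : ℕ) (e : ℕ → R), ((List.range m).map e).sum = ∑ j ∈ Finset.range m, e j := by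
      intro m e
      induction m with
      | zero => simp
      | succ m ih => simp [List.range_succ, Finset.sum_range_succ, ih]
    rw [hsum]
    refine Finset.sum_congr rfl fun j hj => ?_
    have hjd := Finset.mem_range.1 hj
    simp only [Function.comp_apply]
    rw [aeval_term, Finset.prod_range_succ, if_neg hjd.ne', if_pos rfl]
    congr 1
    rw [Finset.prod_eq_single j, if_pos rfl, pow_one]
    · intro k hk hkj
      rw [if_neg hkj, if_neg (Finset.mem_range.1 hk).ne, pow_zero]
    · exact fun h => absurd hj h

theorem polyVar_linearFamily (d : ℕ) : polyVar (linearFamily d) = d + 1 := by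
  refine polyVar_eq (f := fun _ => 0) (g := fun j => if j = d then 1 else 0) ?_
    (fun j hj => by simp [hj]) ?_
  · rw [linearFamily, polyOfTerms]
    refine Subalgebra.list_sum_mem _ fun p hp => ?_
    obtain ⟨t, ht, rfl⟩ := List.mem_map.1 hp
    have hl : t.2.length = d + 1 := by
      simp only [linearFamilyTerms, List.mem_cons, List.mem_map] at ht
      rcases ht with rfl | ⟨j, -, rfl⟩ <;> simp
    refine mul_mem (Subalgebra.algebraMap_mem _ t.1) (Subalgebra.prod_mem _ fun j hj => ?_)
    rw [hl, Finset.mem_range] at hj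
    have hjd : j ∈ {j | j ≤ d} := Nat.lt_succ_iff.1 hj
    exact pow_mem ((MvPolynomial.X_mem_supported (R := ℤ)).2 hjd) _
  · rw [aeval_linearFamily, aeval_linearFamily]
    have : ∀ j ∈ Finset.range d,
        (if j = d then (1 : ℤ) else 0) * (if d = d then 1 else 0) ^ j = 0 := fun j hj => by
      rw [if_neg (Finset.mem_range.1 hj).ne, zero_mul]
    rw [Finset.sum_eq_zero this]
    simp

theorem primrec_linearFamilyTerms : Primrec linearFamilyTerms := by
  have hr : Primrec fun d : ℕ => List.range (d + 1) := Primrec.list_range.comp Primrec.succ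
  refine Primrec.list_cons.comp ((Primrec.const 1).pair (Primrec.list_map hr ?_))
    (Primrec.list_map Primrec.list_range ((Primrec.const 1).pair (Primrec.list_map
      (hr.comp Primrec.fst) ?_)))
  · exact Primrec.ite (Primrec.eq.comp Primrec.snd Primrec.fst) (Primrec.const 1) (Primrec.const 0)
  · refine Primrec.ite (Primrec.eq.comp Primrec.snd (Primrec.snd.comp Primrec.fst))
      (Primrec.const 1) (Primrec.ite (Primrec.eq.comp Primrec.snd (Primrec.fst.comp Primrec.fst))
        (Primrec.snd.comp Primrec.fst) (Primrec.const 0))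

/-- The value at `t` of the polynomial with the list of coefficients `l`, constant term first,
evaluated by Horner's rule. -/
def horner {R : Type*} [CommRing R] (t : R) (l : List R) : R := l.foldr (fun a s => a + t * s) 0

theorem horner_eq_sum {R : Type*} [CommRing R] (t : R) (l : List R) :
    horner t l = ∑ j ∈ Finset.range l.length, l.getD j 0 * t ^ j := by
  induction l with
  | nil => simp [horner]
  | cons a l ih =>
    rw [List.length_cons, Finset.sum_range_succ']
    show a + t * horner t l = _
    rw [ih, Finset.mul_sum, add_comm]
    simp [pow_succ]
    refine Finset.sum_congr rfl fun j _ => ?_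
    ring

theorem exists_horner_eq_aeval {F : Type u} [Field F] (q : Polynomial F) :
    ∃ c : List F, ∀ {K : Type v} [Field K] [Algebra F K] (t : K),
      horner t (c.map (algebraMap F K)) = Polynomial.aeval t q := by
  refine ⟨(List.range (q.natDegree + 1)).map q.coeff, fun t => ?_⟩
  rw [horner_eq_sum, Polynomial.aeval_eq_sum_range]
  simp only [List.length_map, List.length_range]
  refine Finset.sum_congr rfl fun j hj => ?_
  rw [List.getD_eq_getElem _ _ (by simpa using hj)]
  simp [Algebra.smul_def]

theorem polyEval_linearFamily {K : Type u} [Field K] {b : List K} {t : K} {l : List K} :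
    PolyEval (linearFamily b.length) (b ++ [t]) l ↔ l = [t + horner t b] := by
  rw [PolyEval, polyVar_linearFamily, aeval_linearFamily, horner_eq_sum]
  have h : ∑ j ∈ Finset.range b.length, (b ++ [t]).getD j 0 * (b ++ [t]).getD b.length 0 ^ j =
      ∑ j ∈ Finset.range b.length, b.getD j 0 * t ^ j := by
    refine Finset.sum_congr rfl fun j hj => ?_
    rw [List.getD_append _ _ _ _ (Finset.mem_range.1 hj)]
    simp
  rw [h]
  simp

theorem PolyEval.map {K : Type u} [Field K] (f : K →+* K) {p : MvPolynomial ℕ ℤ}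
    {s t : List K} (h : PolyEval p s t) : PolyEval p (s.map f) (t.map f) := by
  refine ⟨by simpa using h.1, ?_⟩
  rw [h.2, List.map_singleton]
  congr 1
  have : ∀ j, (s.map f).getD j 0 = f (s.getD j 0) := fun j => by
    conv_lhs => rw [← map_zero f]
    exact List.getD_map _ _ _
  simp only [this]
  exact (MvPolynomial.map_aeval _ _ _).trans (by
    rw [MvPolynomial.aeval_def, MvPolynomial.coe_eval₂Hom]
    congr 1
    exact RingHom.ext_int _ _)

namespace CohPow

variable {C : Set ℕ}

/-- The hyper-polynomial `linearFamily d` for a non-standard number `d`. -/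
def hyperLinearFamily (d : CohPow C ℕ) : CohPow C (MvPolynomial ℕ ℤ) :=
  map linearFamily
    ⟨fun d => Encodable.encode (linearFamilyTerms d),
      (Primrec.encode.comp primrec_linearFamilyTerms).to_comp, by
      rintro n d rfl
      exact ⟨_, rfl, rfl⟩⟩ d

end CohPow

/-! ### Hyper-tuples -/

/-- The entrywise extension of a computable map to tuples is computable on names. -/
theorem exists_names_listMap {A : Type u} {B : Type v} [Coded A] [Coded B] {f : A → B} {g : ℕ → ℕ}
    (hg : Computable g) (hgf : ∀ a, g (Coded.code a) = Coded.code (f a)) :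
    ∃ g' : ℕ → ℕ, Computable g' ∧ ∀ n l, Numbered.Names n l →
      Numbered.Names (g' n) (List.map f l) := by
  refine ⟨fun n => Encodable.encode (((Encodable.decode n : Option (List ℕ)).getD []).map g),
    ?_, ?_⟩
  · exact Computable.encode.comp (Computable.list_map (g := fun _ b => g b)
      (Computable.option_getD Computable.decode (Computable.const [])) (hg.comp Computable.snd))
  · intro n l h
    have h' := (isKey_list n l).1 h
    refine (isKey_list _ _).2 ?_
    rw [← h']
    simp [hgf]

namespace CohPow

variable {C : Set ℕ} {K : Type v} [Coded K] [Nonempty K]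

theorem exists_append (a b : CohPow C (List K)) :
    ∃ c : CohPow C (List K), ∀ᶠ i in almost C, c.val i = a.val i ++ b.val i := by
  obtain ⟨c, hc⟩ := exists_of_computable isKey_list isKey_list isKey_list
    (f := fun a b : List K => some (a ++ b)) (g := fun a b => some (a ++ b))
    (Computable.option_some.comp Computable.list_append) (by simp) a b
    (Eventually.of_forall fun i => ⟨_, rfl⟩)
  exact ⟨c, hc.mono fun i hi => (Option.some.inj hi).symm⟩

theorem exists_take (a : CohPow C (List K)) (J : CohPow C ℕ) :
    ∃ c : CohPow C (List K), ∀ᶠ i in almost C, c.val i = (a.val i).take (J.val i) := by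
  obtain ⟨c, hc⟩ := exists_of_computable isKey_list isKey_id isKey_list
    (f := fun (a : List K) j => some (a.take j)) (g := fun a j => some (a.take j))
    (Computable.option_some.comp
      (Primrec.list_take.to_comp.comp Computable.snd Computable.fst)) (by simp) a J
    (Eventually.of_forall fun i => ⟨_, rfl⟩)
  exact ⟨c, hc.mono fun i hi => (Option.some.inj hi).symm⟩

theorem exists_entry (a : CohPow C (List K)) (J : CohPow C ℕ)
    (h : ∀ᶠ i in almost C, J.val i < (a.val i).length) :
    ∃ x : CohPow C K, ∀ᶠ i in almost C, (a.val i)[J.val i]? = some (x.val i) :=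
  exists_of_computable isKey_list isKey_id isKey_code
    (f := fun (a : List K) j => a[j]?) (g := fun a j => a[j]?)
    Computable.list_getElem? (by simp) a J
    (h.mono fun _ hi => ⟨_, List.getElem?_eq_getElem hi⟩)

theorem exists_eq_single (a : CohPow C (List K)) (h : ∀ᶠ i in almost C, (a.val i).length = 1) :
    ∃ x, a = single x := by
  obtain ⟨x, hx⟩ := exists_entry a (const C 0) (by
    filter_upwards [h, val_const (C := C) 0] with i h₁ h₂
    omega)
  refine ⟨x, ext_val.2 ?_⟩
  filter_upwards [h, hx, val_const (C := C) 0, val_single x] with i h₁ h₂ h₃ h₄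
  obtain ⟨y, hy⟩ := List.length_eq_one_iff.1 h₁
  rw [h₃, hy] at h₂
  rw [h₄, hy]
  simpa using h₂

/-- Different hyper-tuples of the same arity have a first place where they differ. -/
theorem exists_first_difference (hC : IsCohesive C) {s t : CohPow C (List K)}
    (hl : ∀ᶠ i in almost C, (s.val i).length = (t.val i).length) (h : s ≠ t) :
    ∃ J : CohPow C ℕ, ∀ᶠ i in almost C, J.val i < (s.val i).length ∧
      (s.val i).take (J.val i) = (t.val i).take (J.val i) ∧
      (s.val i)[J.val i]? ≠ (t.val i)[J.val i]? := by
  have hinj : Function.Injective (Coded.code : K → ℕ) := Coded.code_injective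
  have hS : PrimrecPred fun t : List ℕ × List ℕ × ℕ =>
      t.1.take t.2.2 = t.2.1.take t.2.2 ∧ ¬ t.1[t.2.2]? = t.2.1[t.2.2]? := by
    have h₁ : Primrec fun t : List ℕ × List ℕ × ℕ => t.2.2 := Primrec.snd.comp Primrec.snd
    have h₂ : Primrec fun t : List ℕ × List ℕ × ℕ => t.2.1 := Primrec.fst.comp Primrec.snd
    exact (Primrec.eq.comp (Primrec.list_take.comp h₁ Primrec.fst)
      (Primrec.list_take.comp h₁ h₂)).and (Primrec.eq.comp
        (Primrec.list_getElem?.comp Primrec.fst h₁) (Primrec.list_getElem?.comp h₂ h₁)).not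
  obtain ⟨J, hJ⟩ := exists_of_re isKey_list isKey_list isKey_id
    (R := fun (s t : List K) j => s.take j = t.take j ∧ ¬ s[j]? = t[j]?)
    (ComputablePred.to_re hS.computablePred) (fun s t n => by
      simp only [← List.map_take, List.getElem?_map, hinj.list_map.eq_iff,
        (Option.map_injective hinj).eq_iff]
      simp) s t (by
      filter_upwards [hl, eventually_ne hC isKey_list h] with i h₁ h₂
      by_contra! hall
      have htake : ∀ j, (s.val i).take j = (t.val i).take j := by
        intro j
        induction j with
        | zero => simp
        | succ j ih => rw [List.take_add_one, List.take_add_one, ih, hall j ih]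
      refine h₂ ?_
      rw [← List.take_length (l := s.val i), htake, h₁, List.take_length])
  refine ⟨J, ?_⟩
  filter_upwards [hl, hJ] with i h₁ h₂
  refine ⟨?_, h₂⟩
  by_contra! hle
  exact h₂.2 (by rw [List.getElem?_eq_none hle, List.getElem?_eq_none (h₁ ▸ hle)])

end CohPow

/-! ### The action of hyper-automorphisms on entries -/

open CohPow

namespace HAut

variable {F : Type u} {K : Type v} [Field F] [Field K] [Algebra F K] [Coded F] [Coded K]
  {C : Set ℕ} (σ : HAut C F K)

theorem length_apply (a : CohPow C (List K)) :
    ∀ᶠ i in almost C, ((σ.1 a).val i).length = (a.val i).length := by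
  filter_upwards [ext_val.1 (σ.2.1.1.2.2 a), val_arity a, val_arity (σ.1 a)] with i h₁ h₂ h₃
  rw [← h₂, ← h₃, h₁]

theorem append_apply {a b c : CohPow C (List K)}
    (h : ∀ᶠ i in almost C, c.val i = a.val i ++ b.val i) :
    ∀ᶠ i in almost C, (σ.1 c).val i = (σ.1 a).val i ++ (σ.1 b).val i :=
  (holds₃_iff.1 ((σ.2.1.1.2.1 a b c).2 (holds₃_iff.2 (h.mono fun _ => Eq.symm)))).mono
    fun _ => Eq.symm

theorem prefix_apply {a b : CohPow C (List K)}
    (h : ∀ᶠ i in almost C, a.val i <+: b.val i) :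
    ∀ᶠ i in almost C, (σ.1 a).val i <+: (σ.1 b).val i :=
  holds₂_iff.1 ((σ.2.1.1.1 a b).2 (holds₂_iff.2 h))

theorem polyEval_apply {p : CohPow C (MvPolynomial ℕ ℤ)} {a b : CohPow C (List K)}
    (h : ∀ᶠ i in almost C, PolyEval (p.val i) (a.val i) (b.val i)) :
    ∀ᶠ i in almost C, PolyEval (p.val i) ((σ.1 a).val i) ((σ.1 b).val i) :=
  holds₃_iff.1 ((σ.2.1.2 p a b).2 (holds₃_iff.2 h))

theorem apply_eq_self {a : CohPow C (List F)} {b : CohPow C (List K)}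
    (h : ∀ᶠ i in almost C, b.val i = (a.val i).map (algebraMap F K)) : σ.1 b = b :=
  σ.2.2 a b (holds₂_iff.2 (h.mono fun _ => Eq.symm))

theorem exists_apply_single (x : CohPow C K) : ∃ y, σ.1 (single x) = single y := by
  refine exists_eq_single _ ?_
  filter_upwards [length_apply σ (single x), val_single x] with i h₁ h₂
  rw [h₁, h₂, List.length_singleton]

/-- Hyper-automorphisms act on hyper-tuples entry by entry, at all places `J`, standard or not. -/
theorem entry_apply {a : CohPow C (List K)} {J : CohPow C ℕ} {x y : CohPow C K}
    (h : ∀ᶠ i in almost C, (a.val i)[J.val i]? = some (x.val i))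
    (hxy : σ.1 (single x) = single y) :
    ∀ᶠ i in almost C, ((σ.1 a).val i)[J.val i]? = some (y.val i) := by
  -- `σ` preserves the prefix of length `J` followed by the entry `x`
  obtain ⟨b, hb⟩ := exists_take a J
  obtain ⟨c, hc⟩ := exists_append b (single x)
  have hca : ∀ᶠ i in almost C, c.val i <+: a.val i := by
    filter_upwards [h, hb, hc, val_single x] with i h₁ h₂ h₃ h₄
    have : a.val i = (a.val i).take (J.val i + 1) ++ (a.val i).drop (J.val i + 1) := by simp
    rw [List.take_add_one, h₁] at this
    exact ⟨_, by rw [h₃, h₂, h₄]; exact this.symm⟩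
  filter_upwards [h, hb, prefix_apply σ hca, append_apply σ hc, length_apply σ b,
    val_single y] with i h₁ h₂ h₃ h₄ h₅ h₆
  have hl : ((σ.1 b).val i).length = J.val i := by
    rw [h₅, h₂, List.length_take, min_eq_left]
    exact ((List.getElem?_eq_some_iff.1 h₁).1).le
  obtain ⟨d, hd⟩ := h₃
  rw [← hd, h₄, hxy, h₆, ← hl]
  simp

/-- Hyper-automorphisms that agree on hyper-tuples of arity `1` agree on all hyper-tuples. -/
theorem ext_single (hC : IsCohesive C) {σ τ : HAut C F K}
    (h : ∀ x, σ.1 (single x) = τ.1 (single x)) : σ = τ := by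
  refine Subtype.ext (Equiv.ext fun a => ?_)
  by_contra hne
  have hl : ∀ᶠ i in almost C, ((σ.1 a).val i).length = ((τ.1 a).val i).length := by
    filter_upwards [length_apply σ a, length_apply τ a] with i h₁ h₂
    rw [h₁, h₂]
  obtain ⟨J, hJ⟩ := exists_first_difference hC hl hne
  obtain ⟨x, hx⟩ := exists_entry a J (by
    filter_upwards [hJ, length_apply σ a] with i h₁ h₂
    exact h₂ ▸ h₁.1)
  obtain ⟨y, hy⟩ := exists_apply_single σ x
  have := hC.neBot
  obtain ⟨i, h₁, h₂, h₃⟩ := (hJ.and ((entry_apply σ hx hy).and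
    (entry_apply τ hx ((h x).symm.trans hy)))).exists
  exact h₁.2.2 (h₂.trans h₃.symm)

/-- If `x` is a polynomial in `t` with coefficients in `∏_C F`, then `σ x` is the same
polynomial in `σ t`. The length of the list of coefficients may be non-standard. -/
theorem horner_apply (P : FullyComputableGalois F K) {c : CohPow C (List F)}
    {t x t' x' : CohPow C K}
    (h : ∀ᶠ i in almost C, x.val i =
      t.val i + horner (t.val i) ((c.val i).map (algebraMap F K)))
    (ht : σ.1 (single t) = single t') (hx : σ.1 (single x) = single x') :
    ∀ᶠ i in almost C, x'.val i =
      t'.val i + horner (t'.val i) ((c.val i).map (algebraMap F K)) := by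
  obtain ⟨g, hg, hgF⟩ := P.computable_algebraMap
  obtain ⟨b, hb⟩ : ∃ b : CohPow C (List K),
      ∀ᶠ i in almost C, b.val i = (c.val i).map (algebraMap F K) :=
    ⟨_, val_map _ (exists_names_listMap (hg.comp (Computable.const 0) Computable.id) (hgF 0)) c⟩
  obtain ⟨e, he⟩ := exists_append b (single t)
  have hp : ∀ᶠ i in almost C, (hyperLinearFamily (arity c)).val i =
      linearFamily (c.val i).length := by
    filter_upwards [val_map linearFamily _ (arity c), val_arity c] with i h₁ h₂
    rw [← h₂]
    exact h₁
  have key : ∀ᶠ i in almost C, PolyEval ((hyperLinearFamily (arity c)).val i) (e.val i)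
      ((single x).val i) := by
    filter_upwards [h, hb, he, hp, val_single t, val_single x] with i h₁ h₂ h₃ h₄ h₅ h₆
    rw [h₃, h₄, h₅, h₆, ← List.length_map (as := c.val i) (algebraMap F K), ← h₂,
      polyEval_linearFamily, h₁, h₂]
  filter_upwards [polyEval_apply σ key, hb, append_apply σ he, hp, val_single t',
    val_single x'] with i h₁ h₂ h₃ h₄ h₅ h₆
  rw [h₃, h₄, hx, ht, h₅, h₆, apply_eq_self σ hb,
    ← List.length_map (as := c.val i) (algebraMap F K), ← h₂, polyEval_linearFamily] at h₁
  rw [← h₂]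
  simpa using h₁

end HAut

/-! ### Restriction of hyper-automorphisms to `K` -/

namespace HAut

variable {F : Type u} {K : Type v} [Field F] [Field K] [Algebra F K] [Coded F] [Coded K]
  {C : Set ℕ} (σ : HAut C F K)

/-- A hyper-automorphism maps standard elements to standard elements: the image of `x` is a root of
the minimal polynomial of `x`, and cohesiveness makes a sequence of such roots constant. -/
theorem exists_apply_const (P : FullyComputableGalois F K) (hC : IsCohesive C) (x : K) :
    ∃ y : K, σ.1 (single (const C x)) = single (const C y) := by
  have := P.isGalois
  obtain ⟨x', hx'⟩ := exists_apply_single σ (const C x)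
  obtain ⟨c, hc⟩ := exists_horner_eq_aeval (minpoly F x)
  -- with the coefficients of the minimal polynomial, the identity `x = x + 0` is carried over
  have key := horner_apply σ P (c := const C c) (by
    filter_upwards [val_const (C := C) c, val_const (C := C) x] with i h₁ h₂
    rw [h₁, h₂, hc, minpoly.aeval, add_zero]) hx' hx'
  obtain ⟨y, -, hy⟩ := exists_eq_const hC isKey_code (x := x')
    (Polynomial.rootSet_finite (minpoly F x) K) (by
    filter_upwards [key, val_const (C := C) c] with i h₁ h₂
    rw [h₂, hc] at h₁
    exact (Polynomial.mem_rootSet_of_ne (minpoly.ne_zero (Algebra.IsIntegral.isIntegral x))).2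
      (left_eq_add.1 h₁))
  exact ⟨y, hy ▸ hx'⟩

theorem single_const_inj (hC : IsCohesive C) {x y : K} :
    single (const C x) = single (const C y) ↔ x = y :=
  single_injective.eq_iff.trans (const_inj hC)

/-- Preservation of standard polynomials in two variables, at standard elements. -/
theorem aeval_apply (hC : IsCohesive C) {p : MvPolynomial ℕ ℤ} (hp : polyVar p = 2)
    {x y z x' y' z' : K} (hz : z = MvPolynomial.aeval (fun j => [x, y].getD j 0) p)
    (hxx : σ.1 (single (const C x)) = single (const C x'))
    (hyy : σ.1 (single (const C y)) = single (const C y'))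
    (hzz : σ.1 (single (const C z)) = single (const C z')) :
    z' = MvPolynomial.aeval (fun j => [x', y'].getD j 0) p := by
  obtain ⟨e, he⟩ := exists_append (single (const C x)) (single (const C y))
  have hsc : ∀ x : K, ∀ᶠ i in almost C, (single (const C x)).val i = [x] := fun x => by
    filter_upwards [val_single (const C x), val_const (C := C) x] with i h₁ h₂
    rw [h₁, h₂]
  have key := polyEval_apply σ (p := const C p) (a := e) (b := single (const C z)) (by
    filter_upwards [he, val_const (C := C) p, hsc x, hsc y, hsc z] with i h₁ h₂ h₃ h₄ h₅
    rw [h₁, h₂, h₃, h₄, h₅, hz]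
    exact ⟨hp, rfl⟩)
  have := hC.neBot
  obtain ⟨i, h₁, h₂, h₃, h₄, h₅, h₆⟩ := (key.and ((val_const (C := C) p).and
    ((append_apply σ he).and ((hsc x').and ((hsc y').and (hsc z')))))).exists
  rw [h₂, h₃, hxx, hyy, hzz, h₄, h₅, h₆] at h₁
  simpa using h₁.2

/-- The restriction of a hyper-automorphism to `K`, as an endomorphism. -/
def restrictAlgHom (P : FullyComputableGalois F K) (hC : IsCohesive C) : K →ₐ[F] K :=
  have h := fun x => (exists_apply_const σ P hC x).choose_spec
  have hF : ∀ r : F, (exists_apply_const σ P hC (algebraMap F K r)).choose = algebraMap F K r := by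
    intro r
    rw [← single_const_inj hC, ← h]
    refine apply_eq_self σ (a := const C [r]) ?_
    filter_upwards [val_single (const C (algebraMap F K r)),
      val_const (C := C) (algebraMap F K r), val_const (C := C) [r]] with i h₁ h₂ h₃
    rw [h₁, h₂, h₃, List.map_singleton]
  { toFun := fun x => (exists_apply_const σ P hC x).choose
    map_one' := by simpa using hF 1
    map_zero' := by simpa using hF 0
    map_add' := fun x y => by
      simpa using aeval_apply σ hC polyVar_add (by simp) (h x) (h y) (h (x + y))
    map_mul' := fun x y => by
      simpa using aeval_apply σ hC polyVar_mul (by simp) (h x) (h y) (h (x * y))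
    commutes' := hF }

theorem restrictAlgHom_spec (P : FullyComputableGalois F K) (hC : IsCohesive C) (x : K) :
    σ.1 (single (const C x)) = single (const C (restrictAlgHom σ P hC x)) :=
  (exists_apply_const σ P hC x).choose_spec

/-- Restriction of hyper-automorphisms to `K`. As `K/F` is algebraic, the endomorphism
`restrictAlgHom` is bijective. -/
def restrict (P : FullyComputableGalois F K) (hC : IsCohesive C) :
    HAut C F K →* (K ≃ₐ[F] K) :=
  have := P.isGalois
  (Algebra.IsAlgebraic.algEquivEquivAlgHom F K).symm.toMonoidHom.comp
    { toFun := fun σ => restrictAlgHom σ P hC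
      map_one' := by
        ext x
        rw [← single_const_inj hC, ← restrictAlgHom_spec]
        rfl
      map_mul' := fun σ τ => by
        ext x
        rw [← single_const_inj hC, ← restrictAlgHom_spec, AlgHom.mul_apply,
          ← restrictAlgHom_spec, ← restrictAlgHom_spec]
        rfl }

theorem restrict_spec (P : FullyComputableGalois F K) (hC : IsCohesive C) (x : K) :
    σ.1 (single (const C x)) = single (const C (restrict P hC σ x)) := by
  have := P.isGalois
  have h : (Algebra.IsAlgebraic.algEquivEquivAlgHom F K) (restrict P hC σ) =
      restrictAlgHom σ P hC :=
    (Algebra.IsAlgebraic.algEquivEquivAlgHom F K).apply_symm_apply _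
  rw [restrictAlgHom_spec σ P hC, ← h]
  rfl

theorem restrict_eq_iff (P : FullyComputableGalois F K) (hC : IsCohesive C) {x y : K} :
    restrict P hC σ x = y ↔ σ.1 (single (const C x)) = single (const C y) := by
  rw [restrict_spec σ P hC, single_const_inj hC]

end HAut

/-! ### Primitive elements of the finite subextensions -/

theorem adjoin_eq_top_iff_injective_gal {F E : Type*} [Field F] [Field E] [Algebra F E]
    [FiniteDimensional F E] [IsGalois F E] (y : E) :
    IntermediateField.adjoin F {y} = ⊤ ↔ Function.Injective fun g : E ≃ₐ[F] E => g y := by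
  rw [Field.primitive_element_iff_algHom_eq_of_eval' F E (fun x => Normal.splits inferInstance x) y]
  exact (Function.Injective.of_comp_iff' (fun φ : E →ₐ[F] E => φ y)
    (Algebra.IsAlgebraic.algEquivEquivAlgHom F E).bijective).symm

namespace FullyComputableGalois

variable {F : Type u} {K : Type v} [Field F] [Field K] [Algebra F K] [Coded F] [Coded K]
  (P : FullyComputableGalois F K) {C : Set ℕ}

/-- Primitive elements of the fields `E n` can be found computably: `y` is primitive if its
images under the elements of `G n`, of which there is a known number, are distinct. -/
theorem exists_primitive_elements : ∃ (θ : ∀ n, P.E n) (t : ℕ → ℕ), Computable t ∧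
    ∀ n, t n = Coded.code (θ n : K) ∧ IntermediateField.adjoin F {θ n} = ⊤ := by
  obtain ⟨act, hact, hactE⟩ := P.computable_action
  obtain ⟨o, ho, hoE⟩ := P.computable_ofE
  -- the certificate `L` lists the codes of all elements of the Galois group
  let S : ℕ × ℕ → Prop := fun s => s.2 ∈ Set.range (P.codeE s.1) ∧ ∃ L : List ℕ,
    L.length = Nat.card (P.E s.1 ≃ₐ[F] P.E s.1) ∧ (∀ c ∈ L, c ∈ Set.range (P.codeG s.1)) ∧
      (L.map fun c => act s.1 c s.2).Nodup
  have hS : REPred S := by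
    refine P.computable_E.decidable.to_re.and (REPred.exists (p := fun s : (ℕ × ℕ) × List ℕ =>
      s.2.length = Nat.card (P.E s.1.1 ≃ₐ[F] P.E s.1.1) ∧
        (∀ c ∈ s.2, c ∈ Set.range (P.codeG s.1.1)) ∧
          (s.2.map fun c => act s.1.1 c s.1.2).Nodup) ?_)
    refine (REPred.eq (Computable.list_length.comp Computable.snd)
      (P.computable_G.card.comp (Computable.fst.comp Computable.fst))).and (.and ?_ ?_)
    · exact (ComputablePred.forall_mem_list
        (p := fun s : ((ℕ × ℕ) × List ℕ) × ℕ => s.2 ∈ Set.range (P.codeG s.1.1.1)) Computable.snd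
        (P.computable_G.decidable.comp (f := fun s : ((ℕ × ℕ) × List ℕ) × ℕ => (s.1.1.1, s.2))
          ((Computable.fst.comp (Computable.fst.comp Computable.fst)).pair Computable.snd))).to_re
    · refine (primrecPred_nodup.computablePred.comp (Computable.list_map
        (g := fun (s : (ℕ × ℕ) × List ℕ) c => act s.1.1 c s.1.2) Computable.snd ?_)).to_re
      exact hact.comp (f := fun t : ℕ × ℕ × ℕ => act t.1 t.2.1 t.2.2)
        (g := fun s : ((ℕ × ℕ) × List ℕ) × ℕ => (s.1.1.1, s.2, s.1.1.2))
        ((Computable.fst.comp (Computable.fst.comp Computable.fst)).pair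
          (Computable.snd.pair (Computable.snd.comp (Computable.fst.comp Computable.fst))))
  obtain ⟨e, he, heS⟩ := exists_computable_choice (p := fun _ : ℕ => True)
    (ComputablePred.computable_iff.2 ⟨fun _ => true, Computable.const true, by simp⟩) hS (by
    intro n _
    have := P.finiteDimensional_E n
    have := P.isGalois_E n
    obtain ⟨y, hy⟩ := Field.exists_primitive_element F (P.E n)
    have : Fintype (P.E n ≃ₐ[F] P.E n) := Fintype.ofFinite _
    refine ⟨P.codeE n y, ⟨y, rfl⟩, Finset.univ.toList.map (P.codeG n), ?_, ?_, ?_⟩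
    · rw [List.length_map, Finset.length_toList, Finset.card_univ, Nat.card_eq_fintype_card]
    · intro c hc
      obtain ⟨g, -, rfl⟩ := List.mem_map.1 hc
      exact ⟨g, rfl⟩
    · rw [List.map_map]
      refine List.Nodup.map (fun g h hgh => ?_) (Finset.nodup_toList _)
      simp only [Function.comp_apply, hactE] at hgh
      exact (adjoin_eq_top_iff_injective_gal y).1 hy (P.computable_E.injective n hgh))
  have hθ : ∀ n, ∃ y : P.E n, P.codeE n y = e n := fun n => (heS n trivial).1
  choose θ hθ using hθ
  refine ⟨θ, fun n => o n (e n), ho.comp Computable.id he, fun n => ⟨?_, ?_⟩⟩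
  · simp only [← hθ, hoE]
  · obtain ⟨-, L, hL, hLG, hnd⟩ := heS n trivial
    have := P.finiteDimensional_E n
    have := P.isGalois_E n
    rw [adjoin_eq_top_iff_injective_gal]
    simp only at hL hLG hnd
    obtain ⟨M, rfl⟩ : ∃ M : List (P.E n ≃ₐ[F] P.E n), M.map (P.codeG n) = L :=
      (Set.range_list_map (P.codeG n)).ge hLG
    rw [List.map_map] at hnd
    have hM : M.Nodup := hnd.of_map _
    have hmem : ∀ g, g ∈ M := by
      classical
      have : Fintype (P.E n ≃ₐ[F] P.E n) := Fintype.ofFinite _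
      rw [List.length_map, Nat.card_eq_fintype_card, ← List.toFinset_card_of_nodup hM] at hL
      intro g
      rw [← List.mem_toFinset, Finset.eq_univ_of_card _ hL]
      exact Finset.mem_univ g
    intro g h hgh
    refine List.inj_on_of_nodup_map hnd (hmem g) (hmem h) ?_
    simp only [Function.comp_apply, ← hθ, hactE]
    exact congrArg _ hgh

/-- A primitive element of `E n` over `F`, as an element of `K`. -/
def theta (n : ℕ) : K := P.exists_primitive_elements.choose n

theorem theta_mem (n : ℕ) : P.theta n ∈ P.E n := (P.exists_primitive_elements.choose n).2

theorem exists_code_theta :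
    ∃ t : ℕ → ℕ, Computable t ∧ ∀ n, t n = Coded.code (P.theta n) := by
  obtain ⟨t, ht, h⟩ := P.exists_primitive_elements.choose_spec
  exact ⟨t, ht, fun n => (h n).1⟩

/-- The summand `θ_n` is the one that `linearFamily` carries; it is subtracted before expanding in
powers of `θ_n`. -/
theorem exists_eq_horner_theta {n : ℕ} {x : K} (hx : x ∈ P.E n) :
    ∃ c : List F, x = P.theta n + horner (P.theta n) (c.map (algebraMap F K)) := by
  obtain ⟨t, ht, h⟩ := P.exists_primitive_elements.choose_spec
  have := P.finiteDimensional_E n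
  have htop := (h n).2
  set θ := P.exists_primitive_elements.choose n with hθ
  have hxθ : (⟨x, hx⟩ - θ : P.E n) ∈ (IntermediateField.adjoin F {θ}).toSubalgebra := by
    rw [htop]
    trivial
  rw [IntermediateField.adjoin_simple_toSubalgebra_of_isAlgebraic
    (Algebra.IsAlgebraic.isAlgebraic θ), Algebra.adjoin_singleton_eq_range_aeval] at hxθ
  obtain ⟨q, hq⟩ := hxθ
  obtain ⟨c, hc⟩ := exists_horner_eq_aeval q
  refine ⟨c, ?_⟩
  have hq' := congrArg ((↑) : P.E n → K) hq
  have hval : ((Polynomial.aeval θ q : P.E n) : K) = Polynomial.aeval (θ : K) q :=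
    (Polynomial.aeval_algHom_apply (P.E n).val θ q).symm
  rw [hc]
  show x = (θ : K) + Polynomial.aeval (θ : K) q
  rw [← hval]
  have hq'' : ((Polynomial.aeval θ q : P.E n) : K) = x - θ := hq'
  rw [hq'']
  ring

/-- The element `[θ_{N(i)}]` of `∏_C K` given by the primitive elements. -/
def hyperTheta (N : CohPow C ℕ) : CohPow C K :=
  CohPow.map P.theta (by
    obtain ⟨t, ht, h⟩ := P.exists_code_theta
    refine ⟨t, ht, ?_⟩
    rintro n m rfl
    exact (h m).symm) N

theorem val_hyperTheta (N : CohPow C ℕ) :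
    ∀ᶠ i in almost C, (P.hyperTheta N).val i = P.theta (N.val i) :=
  val_map _ _ N

/-- The codes in the presentations of the `E n`, which `hyperSubfield` asks for, can be found by a
search. -/
theorem mem_hyperSubfield {N : CohPow C ℕ} {x : CohPow C K} :
    x ∈ P.hyperSubfield N ↔ ∀ᶠ i in almost C, x.val i ∈ P.E (N.val i) := by
  constructor
  · rintro ⟨ν, φ, ψ, rfl, rfl, -, h⟩
    filter_upwards [h, val_mk ν, val_mk φ] with i ⟨n, hn, y, _, hy⟩ h₂ h₃
    rw [Part.mem_unique h₂ hn, Part.mem_unique h₃ hy]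
    exact y.2
  · intro h
    obtain ⟨ν, hν, hν'⟩ := N.exists_rep
    obtain ⟨φ, hφ, hφ'⟩ := x.exists_rep
    obtain ⟨o, ho, hoE⟩ := P.computable_ofE
    -- `T ((i, e), n, k)`: at `i`, the values of `N` and `x` are `n` and the element with code `k`,
    -- and `e` is the code of that element in `E n`
    let T : (ℕ × ℕ) × ℕ × ℕ → Prop := fun t => (∃ n ∈ ν.toFun t.1.1, id n = t.2.1) ∧
      (∃ a ∈ φ.toFun t.1.1, Coded.code a = t.2.2) ∧ t.1.2 ∈ Set.range (P.codeE t.2.1) ∧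
        o t.2.1 t.1.2 = t.2.2
    have c₁ : Computable fun t : (ℕ × ℕ) × ℕ × ℕ => t.1.1 := Computable.fst.comp Computable.fst
    have c₂ : Computable fun t : (ℕ × ℕ) × ℕ × ℕ => t.1.2 := Computable.snd.comp Computable.fst
    have c₃ : Computable fun t : (ℕ × ℕ) × ℕ × ℕ => t.2.1 := Computable.fst.comp Computable.snd
    have c₄ : Computable fun t : (ℕ × ℕ) × ℕ × ℕ => t.2.2 := Computable.snd.comp Computable.snd
    have hT : REPred T := ((isKey_id.rePred_graph ν).comp (c₁.pair c₃)).and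
      (((isKey_code.rePred_graph φ).comp (c₁.pair c₄)).and
        ((P.computable_E.decidable.comp (c₃.pair c₂)).to_re.and (REPred.eq (ho.comp c₃ c₂) c₄)))
    obtain ⟨ψ, hψ, hψT, hψd⟩ := hT.exists.exists_partrec
    refine ⟨ν, φ, ψ, hν, hφ, hψ, ?_⟩
    filter_upwards [h, hν', hφ'] with i h₁ h₂ h₃
    have hd : (ψ i).Dom := hψd i (P.codeE (N.val i) ⟨x.val i, h₁⟩)
      ⟨(N.val i, Coded.code (x.val i)), ⟨_, h₂, rfl⟩, ⟨_, h₃, rfl⟩, ⟨_, rfl⟩, hoE _ _⟩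
    obtain ⟨⟨_, _⟩, ⟨n, hn, rfl⟩, ⟨a, ha, rfl⟩, ⟨y, hy⟩, hya⟩ := hψT i _ (Part.get_mem hd)
    refine ⟨n, hn, y, ?_, ?_⟩
    · have hy' : P.codeE n y = (ψ i).get hd := hy
      rw [hy']
      exact Part.get_mem hd
    · have hy' : P.codeE n y = (ψ i).get hd := hy
      have hya' : o n ((ψ i).get hd) = Coded.code a := hya
      rw [← hy', hoE] at hya'
      have hya'' : (y : K) = a := Coded.code_injective hya'
      exact hya'' ▸ ha

theorem hyperTheta_mem (N : CohPow C ℕ) : P.hyperTheta N ∈ P.hyperSubfield N := by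
  rw [mem_hyperSubfield]
  filter_upwards [P.val_hyperTheta N] with i h
  rw [h]
  exact P.theta_mem _

theorem exists_mem_hyperSubfield (x : CohPow C K) : ∃ N, x ∈ P.hyperSubfield N := by
  obtain ⟨o, ho, hoE⟩ := P.computable_ofE
  have hR : REPred fun t : (ℕ × ℕ × ℕ) × ℕ =>
      t.2 ∈ Set.range (P.codeE t.1.2.2) ∧ o t.1.2.2 t.2 = t.1.1 := by
    have c₁ : Computable fun t : (ℕ × ℕ × ℕ) × ℕ => t.1.2.2 :=
      Computable.snd.comp (Computable.snd.comp Computable.fst)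
    exact (P.computable_E.decidable.comp (c₁.pair Computable.snd)).to_re.and
      (REPred.eq (ho.comp c₁ Computable.snd) (Computable.fst.comp Computable.fst))
  obtain ⟨N, hN⟩ := exists_of_re isKey_code isKey_code isKey_id
    (R := fun (x _ : K) n => x ∈ P.E n) hR.exists (fun x _ n => by
      simp only [id, exists_eq_left]
      constructor
      · rintro ⟨e, ⟨y, rfl⟩, h⟩
        rw [hoE] at h
        rw [← Coded.code_injective h]
        exact y.2
      · intro h
        exact ⟨_, ⟨⟨x, h⟩, rfl⟩, hoE n ⟨x, h⟩⟩) x x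
    (Eventually.of_forall fun i => P.exists_mem_E _)
  exact ⟨N, P.mem_hyperSubfield.2 hN⟩

/-- The coefficients that express the elements of `∏_{C,N} E_i` by `[θ_{N(i)}]` can be found
computably. -/
theorem exists_hyper_eq_horner {N : CohPow C ℕ} {x : CohPow C K} (hx : x ∈ P.hyperSubfield N) :
    ∃ c : CohPow C (List F), ∀ᶠ i in almost C, x.val i = (P.hyperTheta N).val i +
      horner ((P.hyperTheta N).val i) ((c.val i).map (algebraMap F K)) := by
  obtain ⟨ι, hι, hιF⟩ := P.computable_algebraMap
  obtain ⟨add, hadd, haddK⟩ := P.computable_K.add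
  obtain ⟨mul, hmul, hmulK⟩ := P.computable_K.mul
  -- Horner's rule on codes
  let f : ℕ → List ℕ → ℕ := fun v l =>
    l.foldr (fun a s => add 0 (ι 0 a) (mul 0 v s)) (Coded.code (0 : K))
  have hf : Computable₂ f := by
    refine Computable.list_foldr (f := fun p : ℕ × List ℕ => p.2)
      (h := fun p q => add 0 (ι 0 q.1) (mul 0 p.1 q.2)) Computable.snd (Computable.const _) ?_
    exact hadd.comp (g := fun t : (ℕ × List ℕ) × ℕ × ℕ =>
        (0, ι 0 t.2.1, mul 0 t.1.1 t.2.2)) ((Computable.const 0).pair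
      ((hι.comp (Computable.const 0) (Computable.fst.comp Computable.snd)).pair
        (hmul.comp (g := fun t : (ℕ × List ℕ) × ℕ × ℕ => (0, t.1.1, t.2.2))
          ((Computable.const 0).pair ((Computable.fst.comp Computable.fst).pair
            (Computable.snd.comp Computable.snd))))))
  have hfK : ∀ (t : K) (c : List F), f (Coded.code t) (c.map Coded.code) =
      Coded.code (horner t (c.map (algebraMap F K))) := by
    intro t c
    induction c with
    | nil => rfl
    | cons a c ih =>
      show add 0 (ι 0 (Coded.code a)) (mul 0 (Coded.code t)
        (f (Coded.code t) (c.map Coded.code))) = _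
      rw [ih, hmulK, hιF, haddK]
      rfl
  have hS : REPred fun t : ℕ × ℕ × List ℕ =>
      (∀ a ∈ t.2.2, a ∈ Set.range (Coded.code : F → ℕ)) ∧ add 0 t.2.1 (f t.2.1 t.2.2) = t.1 := by
    have c₁ : Computable fun t : ℕ × ℕ × List ℕ => t.2.1 := Computable.fst.comp Computable.snd
    have c₂ : Computable fun t : ℕ × ℕ × List ℕ => t.2.2 := Computable.snd.comp Computable.snd
    refine (ComputablePred.forall_mem_list
      (p := fun t : (ℕ × ℕ × List ℕ) × ℕ => t.2 ∈ Set.range (Coded.code : F → ℕ)) c₂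
      (P.computable_F.decidable.comp (f := fun t : (ℕ × ℕ × List ℕ) × ℕ => (0, t.2))
        ((Computable.const 0).pair Computable.snd))).to_re.and (REPred.eq ?_ Computable.fst)
    exact hadd.comp (g := fun t : ℕ × ℕ × List ℕ => (0, t.2.1, f t.2.1 t.2.2))
      ((Computable.const 0).pair (c₁.pair (hf.comp c₁ c₂)))
  refine exists_of_re isKey_code isKey_code isKey_list
    (R := fun (x t : K) (c : List F) => x = t + horner t (c.map (algebraMap F K))) hS ?_ x
    (P.hyperTheta N) ?_
  · intro x t l
    constructor
    · rintro ⟨hl, h⟩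
      obtain ⟨c, rfl⟩ : ∃ c : List F, c.map Coded.code = l :=
        (Set.range_list_map (Coded.code : F → ℕ)).ge hl
      simp only [hfK, haddK] at h
      exact ⟨c, rfl, (Coded.code_injective h).symm⟩
    · rintro ⟨c, rfl, h⟩
      refine ⟨fun a ha => ?_, ?_⟩
      · obtain ⟨b, -, rfl⟩ := List.mem_map.1 ha
        exact ⟨b, rfl⟩
      · simp only [hfK, haddK]
        rw [h]
  · filter_upwards [P.mem_hyperSubfield.1 hx, P.val_hyperTheta N] with i h₁ h₂
    rw [h₂]
    exact P.exists_eq_horner_theta h₁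

/-- Hyper-automorphisms that agree at `[θ_{N(i)}]` agree on `∏_{C,N} E_i`. -/
theorem eq_on_hyperSubfield {σ τ : HAut C F K} {N : CohPow C ℕ}
    (h : σ.1 (single (P.hyperTheta N)) = τ.1 (single (P.hyperTheta N))) {x : CohPow C K}
    (hx : x ∈ P.hyperSubfield N) : σ.1 (single x) = τ.1 (single x) := by
  obtain ⟨c, hc⟩ := P.exists_hyper_eq_horner hx
  obtain ⟨t, ht⟩ := HAut.exists_apply_single σ (P.hyperTheta N)
  obtain ⟨y, hy⟩ := HAut.exists_apply_single σ x
  obtain ⟨z, hz⟩ := HAut.exists_apply_single τ x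
  rw [hy, hz]
  congr 1
  rw [ext_val]
  filter_upwards [HAut.horner_apply σ P hc ht hy, HAut.horner_apply τ P hc (h ▸ ht) hz] with i
    h₁ h₂
  rw [h₁, h₂]

theorem differAt_iff {σ τ : HAut C F K} {N : CohPow C ℕ} :
    P.DifferAt σ τ N ↔ σ.1 (single (P.hyperTheta N)) ≠ τ.1 (single (P.hyperTheta N)) :=
  ⟨fun ⟨_, hx, hne⟩ h => hne (P.eq_on_hyperSubfield h hx), fun h => ⟨_, P.hyperTheta_mem N, h⟩⟩

/-! ### The hyper-distance -/

/-- The hyper-tuple `(θ_0, …, θ_{M(i)})`. -/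
theorem exists_theta_tuple (M : CohPow C ℕ) : ∃ a : CohPow C (List K),
    ∀ᶠ i in almost C, a.val i = (List.range (M.val i + 1)).map P.theta := by
  obtain ⟨t, ht, htK⟩ := P.exists_code_theta
  refine ⟨CohPow.map (fun m => (List.range (m + 1)).map P.theta)
    ⟨fun m => Encodable.encode ((List.range (m + 1)).map t), ?_, ?_⟩ M, val_map _ _ M⟩
  · exact Computable.encode.comp (Computable.list_map (g := fun _ j => t j)
      (Primrec.list_range.comp Primrec.succ).to_comp (ht.comp Computable.snd))
  · rintro n m rfl
    rw [isKey_list]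
    simp [htK]

/-- The least `N` is the first place where the images of a tuple `(θ_0, …, θ_M)` differ. -/
theorem exists_isLeast_differAt (hC : IsCohesive C) {σ τ : HAut C F K} (hne : σ ≠ τ) :
    ∃ N, IsLeast {N | P.DifferAt σ τ N} N := by
  obtain ⟨x, hx⟩ : ∃ x, σ.1 (single x) ≠ τ.1 (single x) := by
    by_contra! h
    exact hne (HAut.ext_single hC h)
  obtain ⟨M, hM⟩ := P.exists_mem_hyperSubfield x
  have hMd := P.differAt_iff.1 ⟨x, hM, hx⟩
  obtain ⟨a, ha⟩ := P.exists_theta_tuple M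
  have hentry : ∀ N : CohPow C ℕ, (∀ᶠ i in almost C, N.val i ≤ M.val i) →
      ∀ᶠ i in almost C, (a.val i)[N.val i]? = some ((P.hyperTheta N).val i) := by
    intro N hN
    filter_upwards [hN, ha, P.val_hyperTheta N] with i h₁ h₂ h₃
    rw [h₂, h₃, List.getElem?_map, List.getElem?_range (by omega)]
    rfl
  -- the images of `θ_N` under `σ` and `τ` are the entries number `N` of the images of `a`
  have himage : ∀ N : CohPow C ℕ, (∀ᶠ i in almost C, N.val i ≤ M.val i) →
      (σ.1 (single (P.hyperTheta N)) = τ.1 (single (P.hyperTheta N)) ↔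
        ∀ᶠ i in almost C, ((σ.1 a).val i)[N.val i]? = ((τ.1 a).val i)[N.val i]?) := by
    intro N hN
    obtain ⟨y, hy⟩ := HAut.exists_apply_single σ (P.hyperTheta N)
    obtain ⟨z, hz⟩ := HAut.exists_apply_single τ (P.hyperTheta N)
    have h₁ := HAut.entry_apply σ (hentry N hN) hy
    have h₂ := HAut.entry_apply τ (hentry N hN) hz
    rw [hy, hz, single_injective.eq_iff, ext_val]
    constructor <;> intro h <;> filter_upwards [h, h₁, h₂] with i h h₁ h₂
    · rw [h₁, h₂, h]
    · exact Option.some.inj (h₁.symm.trans (h.trans h₂))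
  obtain ⟨N, hN⟩ := exists_first_difference (s := σ.1 a) (t := τ.1 a) hC
    (by
      filter_upwards [HAut.length_apply σ a, HAut.length_apply τ a] with i h₁ h₂
      rw [h₁, h₂])
    (fun h => hMd ((himage M (Eventually.of_forall fun _ => le_rfl)).2 (by
      rw [h]
      exact Eventually.of_forall fun _ => rfl)))
  have hNM : ∀ᶠ i in almost C, N.val i ≤ M.val i := by
    filter_upwards [hN, HAut.length_apply σ a, ha] with i h₁ h₂ h₃
    have := h₁.1
    rw [h₂, h₃, List.length_map, List.length_range] at this
    omega
  have := hC.neBot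
  refine ⟨N, ?_, fun N' hN' => ?_⟩
  · refine P.differAt_iff.2 fun h => ?_
    obtain ⟨i, h₁, h₂⟩ := (hN.and ((himage N hNM).1 h)).exists
    exact h₁.2.2 h₂
  · refine (lt_or_le hC N' N).resolve_left fun hlt => P.differAt_iff.1 hN' ?_
    refine (himage N' ?_).2 ?_
    · filter_upwards [hlt, hNM] with i h₁ h₂ using (h₁.trans_le h₂).le
    · filter_upwards [hlt, hN] with i h₁ h₂
      rw [← List.getElem?_take_of_lt h₁, h₂.2.1, List.getElem?_take_of_lt h₁]

theorem hyperDist_eq {σ τ : HAut C F K} {N : CohPow C ℕ} (hne : σ ≠ τ)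
    (hN : IsLeast {N | P.DifferAt σ τ N} N) : P.hyperDist σ τ = twoPowNeg N := by
  have h : ∃ N, IsLeast {N | P.DifferAt σ τ N} N := ⟨N, hN⟩
  rw [hyperDist, if_neg hne, dif_pos h]
  congr 1
  exact CohPow.le_antisymm (h.choose_spec.2 hN.1) (hN.2 h.choose_spec.1)

/-- On the standard fields, `σ` and `τ` differ if and only if their restrictions to `K` do. -/
theorem differAt_const_iff (hC : IsCohesive C) {σ τ : HAut C F K} {n : ℕ} :
    P.DifferAt σ τ (const C n) ↔
      ∃ x ∈ P.E n, HAut.restrict P hC σ x ≠ HAut.restrict P hC τ x := by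
  constructor
  · intro h
    refine ⟨P.theta n, P.theta_mem n, fun he => P.differAt_iff.1 h ?_⟩
    have hθ : P.hyperTheta (const C n) = const C (P.theta n) := CohPow.map_const _ _ n
    rw [hθ, HAut.restrict_spec σ P hC, HAut.restrict_spec τ P hC, he]
  · rintro ⟨x, hx, hne⟩
    refine ⟨const C x, P.mem_hyperSubfield.2 ?_, fun h => hne ?_⟩
    · filter_upwards [val_const (C := C) x, val_const (C := C) n] with i h₁ h₂
      rwa [h₁, h₂]
    · rwa [HAut.restrict_spec σ P hC, HAut.restrict_spec τ P hC, HAut.single_const_inj hC] at h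

theorem mem_INF_iff (hC : IsCohesive C) {σ : HAut C F K} :
    σ ∈ P.INF C ↔ HAut.restrict P hC σ = 1 := by
  constructor
  · rintro (rfl | ⟨N, hN, hd⟩)
    · exact map_one _
    · by_contra hne
      have hσ : (1 : HAut C F K) ≠ σ := by
        rintro rfl
        exact hne (map_one _)
      obtain ⟨M, hM⟩ := P.exists_isLeast_differAt hC hσ
      rw [P.hyperDist_eq hσ hM] at hd
      obtain rfl := twoPowNeg_injective hd
      obtain ⟨x, hx⟩ := DFunLike.ne_iff.1 hne
      obtain ⟨n, hn⟩ := P.exists_mem_E x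
      have := hM.2 ((P.differAt_const_iff hC).2 ⟨x, hn, by rw [map_one]; exact hx.symm⟩)
      obtain ⟨m, rfl⟩ := eq_const_of_le hC this
      exact hN ⟨m, rfl⟩
  · intro h
    by_cases hσ : σ = 1
    · exact Or.inl hσ
    · obtain ⟨N, hN⟩ := P.exists_isLeast_differAt hC (Ne.symm hσ)
      refine Or.inr ⟨N, ?_, P.hyperDist_eq (Ne.symm hσ) hN⟩
      rintro ⟨n, rfl⟩
      obtain ⟨x, -, hx⟩ := (P.differAt_const_iff hC).1 hN.1
      exact hx (by rw [h, map_one])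

theorem hyperDist_eq_const (hC : IsCohesive C) {σ τ : HAut C F K}
    (hne : HAut.restrict P hC σ ≠ HAut.restrict P hC τ) :
    P.hyperDist σ τ = const C (P.galDist (HAut.restrict P hC σ) (HAut.restrict P hC τ)) := by
  have hστ : σ ≠ τ := fun h => hne (h ▸ rfl)
  obtain ⟨N, hN⟩ := P.exists_isLeast_differAt hC hστ
  obtain ⟨x, hx⟩ := DFunLike.ne_iff.1 hne
  obtain ⟨n, hn⟩ := P.exists_mem_E x
  obtain ⟨m, rfl⟩ := eq_const_of_le hC (hN.2 ((P.differAt_const_iff hC).2 ⟨x, hn, hx⟩))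
  rw [P.hyperDist_eq hστ hN, galDist, if_neg hne, twoPowNeg, CohPow.map_const]
  have hm : IsLeast {n | ∃ x ∈ P.E n, HAut.restrict P hC σ x ≠ HAut.restrict P hC τ x} m :=
    ⟨(P.differAt_const_iff hC).1 hN.1, fun k hk =>
      (const_le_const hC).1 (hN.2 ((P.differAt_const_iff hC).2 hk))⟩
  rw [hm.csInf_eq]

end FullyComputableGalois

/-! ### Hyper-automorphisms induced by computable automorphisms -/

namespace HAut

variable {F : Type u} {K : Type v} [Field F] [Field K] [Algebra F K] [Coded F] [Coded K]
  {C : Set ℕ}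

/-- An automorphism of `K/F` that is computable together with its inverse acts entrywise on
hyper-tuples. -/
theorem exists_of_computable_algEquiv (f : K ≃ₐ[F] K) {g g' : ℕ → ℕ}
    (hg : Computable g) (hgf : ∀ x, g (Coded.code x) = Coded.code (f x))
    (hg' : Computable g') (hgf' : ∀ x, g' (Coded.code x) = Coded.code (f.symm x)) :
    ∃ σ : HAut C F K, ∀ x, σ.1 (single (const C x)) = single (const C (f x)) := by
  let s : CohPow C (List K) → CohPow C (List K) :=
    CohPow.map (List.map f) (exists_names_listMap hg hgf)
  let s' : CohPow C (List K) → CohPow C (List K) :=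
    CohPow.map (List.map f.symm) (exists_names_listMap hg' hgf')
  have hs : ∀ a, ∀ᶠ i in almost C, (s a).val i = (a.val i).map f := val_map _ _
  have hs' : ∀ a, ∀ᶠ i in almost C, (s' a).val i = (a.val i).map f.symm := val_map _ _
  let e : Equiv.Perm (CohPow C (List K)) :=
    { toFun := s
      invFun := s'
      left_inv := fun a => by
        rw [ext_val]
        filter_upwards [hs a, hs' (s a)] with i h₁ h₂
        rw [h₂, h₁]
        simp [Function.comp_def]
      right_inv := fun a => by
        rw [ext_val]
        filter_upwards [hs' a, hs (s' a)] with i h₁ h₂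
        rw [h₂, h₁]
        simp [Function.comp_def] }
  have hinj : Function.Injective (List.map f) := f.injective.list_map
  have hpoly : ∀ (p : MvPolynomial ℕ ℤ) (s t : List K),
      PolyEval p (s.map f) (t.map f) ↔ PolyEval p s t := fun p s t => by
    refine ⟨fun h => ?_, fun h => h.map (f : K →+* K)⟩
    simpa [Function.comp_def] using h.map (f.symm : K →+* K)
  have hmem : e ∈ HAut C F K := by
    refine ⟨⟨⟨fun a b => ?_, fun a b c => ?_, fun a => ?_⟩, fun p a b => ?_⟩, fun a b h => ?_⟩
    · rw [holds₂_iff, holds₂_iff]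
      refine eventually_congr ?_
      filter_upwards [hs a, hs b] with i h₁ h₂
      show (s a).val i <+: (s b).val i ↔ _
      rw [h₁, h₂, List.prefix_map_iff_of_injective f.injective]
    · rw [holds₃_iff, holds₃_iff]
      refine eventually_congr ?_
      filter_upwards [hs a, hs b, hs c] with i h₁ h₂ h₃
      show (s a).val i ++ (s b).val i = (s c).val i ↔ _
      rw [h₁, h₂, h₃, ← List.map_append, hinj.eq_iff]
    · rw [ext_val]
      filter_upwards [hs a, val_arity (s a), val_arity a] with i h₁ h₂ h₃
      show (arity (s a)).val i = _
      rw [h₂, h₁, h₃, List.length_map]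
    · rw [holds₃_iff, holds₃_iff]
      refine eventually_congr ?_
      filter_upwards [hs a, hs b] with i h₁ h₂
      show PolyEval _ ((s a).val i) ((s b).val i) ↔ _
      rw [h₁, h₂, hpoly]
    · show s b = b
      rw [ext_val]
      filter_upwards [hs b, holds₂_iff.1 h] with i h₁ h₂
      rw [h₁, ← h₂]
      simp
  refine ⟨⟨e, hmem⟩, fun x => ?_⟩
  show s (single (const C x)) = single (const C (f x))
  rw [ext_val]
  filter_upwards [hs (single (const C x)), val_single (const C x), val_const (C := C) x,
    val_single (const C (f x)), val_const (C := C) (f x)] with i h₁ h₂ h₃ h₄ h₅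
  rw [h₁, h₂, h₃, h₄, h₅, List.map_singleton]

end HAut

/-! ### Computable automorphisms are dense -/

/-- A coherent sequence of automorphisms of an exhausting chain of intermediate fields has a
limit. -/
theorem exists_algEquiv_of_coherent {F : Type u} {K : Type v} [Field F] [Field K] [Algebra F K]
    [Algebra.IsAlgebraic F K] {E : ℕ → IntermediateField F K} (hE : Monotone E)
    (hex : ∀ x : K, ∃ n, x ∈ E n) (g : ∀ n, E n ≃ₐ[F] E n)
    (hg : ∀ n (x : E n), (g (n + 1) (IntermediateField.inclusion (hE n.le_succ) x) : K) = g n x) :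
    ∃ f : K ≃ₐ[F] K, ∀ n (x : E n), f x = g n x := by
  have key : ∀ n m (hnm : n ≤ m) (x : K) (hx : x ∈ E n),
      (g m ⟨x, hE hnm hx⟩ : K) = g n ⟨x, hx⟩ := by
    intro n m hnm x hx
    induction m, hnm using Nat.le_induction with
    | base => rfl
    | succ m hm ih => rw [← ih]; exact hg m ⟨x, hE hm hx⟩
  choose N hN using hex
  let f₀ : K → K := fun x => g (N x) ⟨x, hN x⟩
  have hf : ∀ n x (hx : x ∈ E n), f₀ x = g n ⟨x, hx⟩ := by
    intro n x hx
    rcases le_total n (N x) with h | h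
    · exact key n _ h x hx
    · exact (key _ n h x (hN x)).symm
  let f : K →ₐ[F] K :=
    { toFun := f₀
      map_one' := by
        rw [hf 0 1 (one_mem _)]
        exact congrArg Subtype.val (map_one (g 0))
      map_zero' := by
        rw [hf 0 0 (zero_mem _)]
        exact congrArg Subtype.val (map_zero (g 0))
      map_add' := fun x y => by
        have hx := hE (le_max_left (N x) (N y)) (hN x)
        have hy := hE (le_max_right (N x) (N y)) (hN y)
        rw [hf _ x hx, hf _ y hy, hf _ (x + y) (add_mem hx hy)]
        exact congrArg Subtype.val (map_add (g _) ⟨x, hx⟩ ⟨y, hy⟩)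
      map_mul' := fun x y => by
        have hx := hE (le_max_left (N x) (N y)) (hN x)
        have hy := hE (le_max_right (N x) (N y)) (hN y)
        rw [hf _ x hx, hf _ y hy, hf _ (x * y) (mul_mem hx hy)]
        exact congrArg Subtype.val (map_mul (g _) ⟨x, hx⟩ ⟨y, hy⟩)
      commutes' := fun r => by
        rw [hf 0 _ ((E 0).algebraMap_mem r)]
        exact congrArg Subtype.val ((g 0).commutes r) }
  refine ⟨(Algebra.IsAlgebraic.algEquivEquivAlgHom F K).symm f, fun n x => ?_⟩
  have : (Algebra.IsAlgebraic.algEquivEquivAlgHom F K)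
      ((Algebra.IsAlgebraic.algEquivEquivAlgHom F K).symm f) = f :=
    (Algebra.IsAlgebraic.algEquivEquivAlgHom F K).apply_symm_apply _
  exact (DFunLike.congr_fun this (x : K)).trans (hf n x x.2)

namespace FullyComputableGalois

variable {F : Type u} {K : Type v} [Field F] [Field K] [Algebra F K] [Coded F] [Coded K]
  (P : FullyComputableGalois F K) {C : Set ℕ}

theorem monotone_E : Monotone P.E := monotone_nat_of_le_succ fun n => (P.E_lt n).le

/-- Elements of `G m` have a counterpart in `G n` with which they agree on the intersection of
`E m` and `E n`: a restriction or an extension. -/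
theorem exists_algEquiv_agree (m n : ℕ) (g : P.E m ≃ₐ[F] P.E m) :
    ∃ h : P.E n ≃ₐ[F] P.E n, ∀ (x : P.E n) (y : P.E m), (x : K) = y → (h x : K) = g y := by
  have := P.isGalois
  have := P.isGalois_E m
  have := P.isGalois_E n
  refine ⟨(g.liftNormal K).restrictNormal (P.E n), fun x y hxy => ?_⟩
  refine (AlgEquiv.restrictNormal_commutes (g.liftNormal K) (P.E n) x).trans ?_
  show g.liftNormal K (x : K) = _
  rw [hxy]
  exact AlgEquiv.liftNormal_commutes g K y

/-- Elements of `G n` can be extended to `G (n + 1)` computably. -/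
theorem exists_computable_extension : ∃ s : ℕ → ℕ → ℕ, Computable₂ s ∧
    ∀ n (g : P.E n ≃ₐ[F] P.E n), ∃ g' : P.E (n + 1) ≃ₐ[F] P.E (n + 1),
      s n (P.codeG n g) = P.codeG (n + 1) g' ∧
        ∀ x : P.E n, (g' (IntermediateField.inclusion (P.E_lt n).le x) : K) = g x := by
  obtain ⟨r, hr, hrG⟩ := P.computable_restrict
  have hS : REPred fun t : (ℕ × ℕ) × ℕ =>
      t.2 ∈ Set.range (P.codeG (t.1.1 + 1)) ∧ r (t.1.1 + 1) t.1.1 t.2 = t.1.2 := by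
    have c₁ : Computable fun t : (ℕ × ℕ) × ℕ => t.1.1 := Computable.fst.comp Computable.fst
    refine (P.computable_G.decidable.comp (f := fun t : (ℕ × ℕ) × ℕ => (t.1.1 + 1, t.2))
      ((Computable.succ.comp c₁).pair Computable.snd)).to_re.and (REPred.eq ?_
        (Computable.snd.comp Computable.fst))
    exact hr.comp (g := fun t : (ℕ × ℕ) × ℕ => (t.1.1 + 1, t.1.1, t.2))
      ((Computable.succ.comp c₁).pair (c₁.pair Computable.snd))
  obtain ⟨s, hs, hsS⟩ := exists_computable_choice P.computable_G.decidable hS (by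
    rintro ⟨n, c⟩ ⟨g, hg⟩
    obtain ⟨h, hh⟩ := P.exists_algEquiv_agree n (n + 1) g
    refine ⟨P.codeG (n + 1) h, ⟨h, rfl⟩, ?_⟩
    exact (hrG _ _ n.lt_succ_self h g fun x y hxy => (hh y x hxy.symm).symm).trans hg)
  refine ⟨fun n c => s (n, c), hs, fun n g => ?_⟩
  obtain ⟨⟨g', hg'⟩, h⟩ := hsS (n, P.codeG n g) ⟨g, rfl⟩
  obtain ⟨g₀, hg₀⟩ := P.exists_algEquiv_agree (n + 1) n g'
  have h' : r (n + 1) n (P.codeG (n + 1) g') = P.codeG n g := hg' ▸ h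
  rw [hrG _ _ n.lt_succ_self g' g₀ hg₀] at h'
  obtain rfl := P.computable_G.injective n h'
  exact ⟨g', hg'.symm, fun x => (hg₀ x _ rfl).symm⟩

/-- Every automorphism of `E n` over `F` extends to a computable automorphism of `K`. -/
theorem exists_computable_algEquiv (n : ℕ) (γ : P.E n ≃ₐ[F] P.E n) :
    ∃ (f : K ≃ₐ[F] K) (g g' : ℕ → ℕ), Computable g ∧ Computable g' ∧
      (∀ x, g (Coded.code x) = Coded.code (f x)) ∧
        (∀ x, g' (Coded.code x) = Coded.code (f.symm x)) ∧ ∀ x : P.E n, f x = γ x := by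
  have := P.isGalois
  obtain ⟨s, hs, hsG⟩ := P.exists_computable_extension
  choose nxt hnxt hext using hsG
  let g : ∀ k, P.E (n + k) ≃ₐ[F] P.E (n + k) := fun k =>
    Nat.rec (motive := fun k => P.E (n + k) ≃ₐ[F] P.E (n + k)) γ (fun k h => nxt (n + k) h) k
  -- the codes of the extensions `g k`
  let c : ℕ → ℕ := fun k => Nat.rec (P.codeG n γ) (fun k h => s (n + k) h) k
  have hc : Computable c := Computable.nat_rec (f := fun k : ℕ => k)
    (h := fun _ (t : ℕ × ℕ) => s (n + t.1) t.2) Computable.id (Computable.const _) (hs.comp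
      (Primrec.nat_add.to_comp.comp (Computable.const n) (Computable.fst.comp Computable.snd))
        (Computable.snd.comp Computable.snd))
  have hcg : ∀ k, c k = P.codeG (n + k) (g k) := by
    intro k
    induction k with
    | zero => rfl
    | succ k ih =>
      show s (n + k) (c k) = _
      rw [ih, hnxt]
      rfl
  obtain ⟨f, hf⟩ := exists_algEquiv_of_coherent (E := fun k => P.E (n + k))
    (fun _ _ h => P.monotone_E (Nat.add_le_add_left h n))
    (fun x => by
      obtain ⟨m, hm⟩ := P.exists_mem_E x
      exact ⟨m, P.monotone_E (Nat.le_add_left m n) hm⟩) g (fun k x => hext _ _ x)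
  obtain ⟨act, hact, hactE⟩ := P.computable_action
  obtain ⟨o, ho, hoE⟩ := P.computable_ofE
  -- the graph of `f`: the value at `x` is found in any of the fields that contain `x`
  have hgraph : REPred fun t : ℕ × ℕ => ∃ q : ℕ × ℕ, q.2 ∈ Set.range (P.codeE (n + q.1)) ∧
      o (n + q.1) q.2 = t.1 ∧ o (n + q.1) (act (n + q.1) (c q.1) q.2) = t.2 := by
    have c₁ : Computable fun t : (ℕ × ℕ) × ℕ × ℕ => n + t.2.1 :=
      Primrec.nat_add.to_comp.comp (Computable.const n) (Computable.fst.comp Computable.snd)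
    have c₂ : Computable fun t : (ℕ × ℕ) × ℕ × ℕ => t.2.2 := Computable.snd.comp Computable.snd
    refine REPred.exists (p := fun t : (ℕ × ℕ) × ℕ × ℕ =>
      t.2.2 ∈ Set.range (P.codeE (n + t.2.1)) ∧ o (n + t.2.1) t.2.2 = t.1.1 ∧
        o (n + t.2.1) (act (n + t.2.1) (c t.2.1) t.2.2) = t.1.2) ?_
    refine (P.computable_E.decidable.comp (c₁.pair c₂)).to_re.and
      ((REPred.eq (ho.comp c₁ c₂) (Computable.fst.comp Computable.fst)).and
        (REPred.eq (ho.comp c₁ ?_) (Computable.snd.comp Computable.fst)))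
    exact hact.comp (g := fun t : (ℕ × ℕ) × ℕ × ℕ => (n + t.2.1, c t.2.1, t.2.2))
      (c₁.pair ((hc.comp (Computable.fst.comp Computable.snd)).pair c₂))
  have hgraph_iff : ∀ u v : ℕ, (∃ q : ℕ × ℕ, q.2 ∈ Set.range (P.codeE (n + q.1)) ∧
      o (n + q.1) q.2 = u ∧ o (n + q.1) (act (n + q.1) (c q.1) q.2) = v) ↔
      ∃ x : K, Coded.code x = u ∧ Coded.code (f x) = v := by
    intro u v
    constructor
    · rintro ⟨⟨k, e⟩, he, rfl, rfl⟩
      obtain ⟨y, rfl⟩ : ∃ y, P.codeE (n + k) y = e := he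
      refine ⟨y, (hoE _ _).symm, ?_⟩
      simp only [hcg, hactE, hoE, hf]
    · rintro ⟨x, rfl, rfl⟩
      obtain ⟨m, hm⟩ := P.exists_mem_E x
      have hx := P.monotone_E (Nat.le_add_left m n) hm
      refine ⟨(m, P.codeE (n + m) ⟨x, hx⟩), ⟨_, rfl⟩, hoE _ _, ?_⟩
      simp only [hcg, hactE, hoE, ← hf]
  have hdec : ComputablePred fun u : ℕ => u ∈ Set.range (Coded.code : K → ℕ) :=
    P.computable_K.decidable.comp (f := fun u : ℕ => (0, u))
      ((Computable.const 0).pair Computable.id)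
  obtain ⟨a, ha, haf⟩ := exists_computable_choice hdec hgraph (by
    rintro _ ⟨x, rfl⟩
    exact ⟨_, (hgraph_iff _ _).2 ⟨x, rfl, rfl⟩⟩)
  obtain ⟨a', ha', haf'⟩ := exists_computable_choice hdec
    (hgraph.comp (f := Prod.swap) (Computable.snd.pair Computable.fst)) (by
      rintro _ ⟨x, rfl⟩
      exact ⟨Coded.code (f.symm x), (hgraph_iff _ _).2
        ⟨f.symm x, rfl, congrArg Coded.code (f.apply_symm_apply x)⟩⟩)
  refine ⟨f, a, a', ha, ha', fun x => ?_, fun x => ?_, fun x => hf 0 x⟩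
  · obtain ⟨y, hy, hy'⟩ := (hgraph_iff _ _).1 (haf _ ⟨x, rfl⟩)
    obtain rfl : y = x := Coded.code_injective hy
    exact hy'.symm
  · obtain ⟨y, hy, hy'⟩ := (hgraph_iff _ _).1 (haf' _ ⟨x, rfl⟩)
    obtain rfl : f y = x := Coded.code_injective hy'
    rw [f.symm_apply_apply]
    exact hy.symm

theorem exists_le_E (L : IntermediateField F K) [FiniteDimensional F L] : ∃ n, L ≤ P.E n := by
  have := P.isGalois
  obtain ⟨y, hy⟩ := Field.exists_primitive_element F L
  obtain ⟨n, hn⟩ := P.exists_mem_E y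
  refine ⟨n, ?_⟩
  have : L = IntermediateField.adjoin F {(y : K)} := by
    have h := congrArg (IntermediateField.map L.val) hy
    rw [IntermediateField.adjoin_map, Set.image_singleton, ← AlgHom.fieldRange_eq_map,
      IntermediateField.fieldRange_val] at h
    exact h.symm
  rw [this, IntermediateField.adjoin_simple_le_iff]
  exact hn

theorem dense_range_restrict (hC : IsCohesive C) :
    Dense ((HAut.restrict P hC).range : Set (K ≃ₐ[F] K)) := by
  have := P.isGalois
  intro γ
  rw [mem_closure_iff_nhds]
  intro U hU
  have hU' : (fun τ => γ * τ) ⁻¹' U ∈ nhds (1 : K ≃ₐ[F] K) :=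
    (continuous_const_mul γ).continuousAt.preimage_mem_nhds (by rwa [mul_one])
  obtain ⟨L, hL, hLU⟩ := (krullTopology_mem_nhds_one_iff F K _).1 hU'
  obtain ⟨n, hn⟩ := P.exists_le_E L
  have := P.isGalois_E n
  obtain ⟨f, g, g', hg, hg', hgf, hgf', hf⟩ :=
    P.exists_computable_algEquiv n (γ.restrictNormal (P.E n))
  obtain ⟨σ, hσ⟩ := HAut.exists_of_computable_algEquiv (C := C) f hg hgf hg' hgf'
  have hσf : HAut.restrict P hC σ = f :=
    AlgEquiv.ext fun x => (HAut.restrict_eq_iff σ P hC).2 (hσ x)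
  refine ⟨f, ?_, σ, hσf⟩
  have : γ⁻¹ * f ∈ (fun τ => γ * τ) ⁻¹' U := by
    refine hLU ((IntermediateField.mem_fixingSubgroup_iff _ _).2 fun x hx => ?_)
    have hx' : f x = γ x := (hf ⟨x, hn hx⟩).trans
      (AlgEquiv.restrictNormal_commutes γ (P.E n) ⟨x, hn hx⟩)
    rw [AlgEquiv.mul_apply, hx']
    exact γ.symm_apply_apply x
  simpa using this

end FullyComputableGalois

end

theorem mainTheorem4 {F K : Type*} [Field F] [Field K] [Algebra F K]
    [Coded F] [Coded K] (P : FullyComputableGalois F K) {C : Set ℕ} (hC : IsCohesive C) :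
    -- the hyper-distance is well defined
    (∀ σ τ : HAut C F K, σ ≠ τ → ∃ N, IsLeast {N | P.DifferAt σ τ N} N) ∧
    -- the infinitesimals form a normal subgroup
    ∃ (I : Subgroup (HAut C F K)) (_ : I.Normal), (I : Set (HAut C F K)) = P.INF C ∧
      -- it consists of the hyper-automorphisms that fix `K`
      (∀ σ : HAut C F K, σ ∈ I ↔
        ∀ x : K, σ.1 (CohPow.single (CohPow.const C x)) = CohPow.single (CohPow.const C x)) ∧
      -- the quotient is isometrically isomorphic to a dense subgroup of `Gal(K/F)`
      ∃ (D : Subgroup (K ≃ₐ[F] K)) (Φ : HAut C F K ⧸ I ≃* D),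
        Dense (D : Set (K ≃ₐ[F] K)) ∧
        -- the isomorphism is induced by the restriction to `K`
        (∀ (σ : HAut C F K) (x : K), σ.1 (CohPow.single (CohPow.const C x)) =
          CohPow.single (CohPow.const C ((Φ (σ : HAut C F K ⧸ I) : K ≃ₐ[F] K) x))) ∧
        -- the hyper-distance of elements of distinct cosets is the distance of their images
        ∀ σ τ : HAut C F K, (σ : HAut C F K ⧸ I) ≠ (τ : HAut C F K ⧸ I) →
          P.hyperDist σ τ = CohPow.const C
            (P.galDist (Φ (σ : HAut C F K ⧸ I)) (Φ (τ : HAut C F K ⧸ I))) := by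
  let ρ : HAut C F K →* (K ≃ₐ[F] K) := HAut.restrict P hC
  refine ⟨fun σ τ hne => P.exists_isLeast_differAt hC hne, ρ.ker, inferInstance,
    Set.ext fun σ => MonoidHom.mem_ker.trans (P.mem_INF_iff hC).symm, fun σ => ?_, ρ.range,
    QuotientGroup.quotientKerEquivRange ρ, P.dense_range_restrict hC,
    fun σ x => HAut.restrict_spec σ P hC x, fun σ τ hne => P.hyperDist_eq_const hC fun h => hne ?_⟩
  · rw [MonoidHom.mem_ker]
    exact AlgEquiv.ext_iff.trans (forall_congr' fun x => HAut.restrict_eq_iff σ P hC)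
  · exact (QuotientGroup.quotientKerEquivRange ρ).injective (Subtype.ext h)
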